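/- **Setting.** Let $\mathcal L$ be a finite set of binary, symmetric, irreflexive relation symbols ("colours"). An $\mathcal L$-structure is *complete* if any two distinct elements $a,b$ are related by exactly one relation, denoted $\mathbf r(a,b)$. A *triangle* is a complete structure on three points, identified up to isomorphism with the unordered triple $xyz$ of its colours. For a set $S$ of triangles, $Forb_c(S)$ is the class of all finite complete structures embedding no triangle of $S$. Let $\mathcal L'=\{R_1,\dots,R_m\}\subsetneq\mathcal L$ be ordered by $R_1>\cdots>R_m$ (the $R_i$ distinct). Assume that $Forb_c(S)$ is a *semi-free amalgamation class with set of solutions $\mathcal L'$*: it is an amalgamation class (Fraïssé class), and for all $A,B,C\in Forb_c(S)$ and embeddings $f_1:B\to A$, $f_2:B\to C$ there are $D\in Forb_c(S)$ and embeddings $g_1:A\to D$, $g_2:C\to D$ with $g_1f_1=g_2f_2$, $g_1(A)\cap g_2(C)=g_1f_1(B)$, and $\mathbf r(a,c)\in\mathcal L'$ for all $a\in g_1(A)\setminus g_1f_1(B)$, $c\in g_2(C)\setminus g_2f_2(B)$. For $B\subseteq A,C$ in $Forb_c(S)$, let $A\otimes_BC$ be the complete structure on the disjoint union of $A$ and $C$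 over $B$ which extends $A$ and $C$ and in which, for $a\in A\setminus B$ and $c\in C\setminus B$, $\mathbf r(a,c)=R_i$ with $i$ least such that $\mathbf r(a,b)\,\mathbf r(b,c)\,R_i\notin S$ for every $b\in B$. $Forb_c(S)$ is a *prioritised semi-free amalgamation class* with respect to $R_1>\cdots>R_m$ if $A\otimes_BC$ is always defined and lies in $Forb_c(S)$. A *Fraïssé limit* $\mathcal M_S$ of $Forb_c(S)$ is a countable homogeneous structure whose age is $Forb_c(S)$. For finite $A,B,C\subseteq\mathcal M_S$ write $A\perp_BC$ if the substructure on $A\cup B\cup C$ is $(A\cup B)\otimes_B(B\cup C)$; in particular $(A\cup B)\cap(B\cup C)=B$. An automorphism $g$ of $\mathcal M_S$ *moves almost maximally* if every 1-type over a finite set $X\subset\mathcal M_S$ (that is, every orbit on $\mathcal M_S$ of the pointwise stabiliser of $X$ in $Aut(\mathcal M_S)$) has a realisation $a$ with $a\perp_Xga$. Put $[h,g]=h^{-1}g^{-1}hg$. Consider the following conditions. * **Condition 1.** $S$ contains no triangle $R_iR_jR'$ with $R_i,R_j\in\mathcal L'$ and $R'\in\mathcal L$. * **Condition 2.** $m=2$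 and there are $\mathcal L^\star\subseteq\mathcal L\setminus\mathcal L'$ and $\hat{\mathcal L}\subseteq\mathcal L\setminus(\mathcal L'\cup\mathcal L^\star)$ such that $S$ contains all triangles $R'R^1R^2$, $R_2R_2R^1$ and $R_2\hat RR^1$ with $R'\in\mathcal L\setminus(\hat{\mathcal L}\cup\{R_2\})$, $R^1,R^2\in\mathcal L^\star$, $\hat R\in\hat{\mathcal L}$, and $S$ contains no other triangle involving $R_1$ or involving $R_2R_2$. * **Main condition.** (i) $S$ contains no triangle involving $R_1R_1$ or (if $m\ge2$) $R_1R_2$. (ii) For all $a,b,c\in\mathcal M_S$ with $b\ne a$, $b\neq c$ and all finite $B\subset\mathcal M_S$: if $\mathbf r(a,b)\in\mathcal L'$ and $a\perp_{B\cup\{b\}}c$, then $a\perp_Bc$. **Theorem.** If $S$ satisfies Condition 1 or Condition 2, then $Forb_c(S)$ is a prioritised semi-free amalgamation class with respect to $R_1>\cdots>R_m$. Moreover, for every Fraïssé limit $\mathcal M_S$ of $Forb_c(S)$, the main condition holds; for every non-trivial $g\in Aut(\mathcal M_S)$ there are $k,h\in Aut(\mathcal M_S)$ such that $[k,[h,g]]$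 moves almost maximally; and $Aut(\mathcal M_S)$ is a simple group. -/

import Mathlib

open scoped FirstOrder
open CategoryTheory

universe u w

namespace SemiFree

/-- One binary relation symbol for every colour in `ι`. -/
inductive ColourRel (ι : Type u) : ℕ → Type u
  | rel : ι → ColourRel ι 2

/-- The relational language whose symbols are the binary relations in `ι`. -/
def colourLanguage (ι : Type u) : FirstOrder.Language.{0, u} := ⟨fun _ => Empty, ColourRel ι⟩

instance (ι : Type u) : (colourLanguage ι).IsRelational :=
  fun _ => (inferInstance : IsEmpty Empty)

variable {ι : Type u}

/-- `Col x a b`: the elements `a` and `b` are related by the relation `x`. -/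
def Col {M : Type w} [(colourLanguage ι).Structure M] (x : ι) (a b : M) : Prop :=
  FirstOrder.Language.Structure.RelMap (L := colourLanguage ι) (ColourRel.rel x) ![a, b]

/-- All relations are symmetric and irreflexive, and any two distinct elements are related by
exactly one relation. -/
structure IsComplete (ι : Type u) (M : Type w) [(colourLanguage ι).Structure M] : Prop where
  irrefl : ∀ (x : ι) (a : M), ¬ Col x a a
  symm : ∀ (x : ι) (a b : M), Col x a b → Col x b a
  existsUnique : ∀ a b : M, a ≠ b → ∃! x : ι, Col x a b

/-- The isomorphism type of the triangle with sides coloured `x`, `y`, `z`: the unordered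
triple of its colours (with multiplicity). -/
def tri (x y z : ι) : Sym ι 3 := x ::ₛ y ::ₛ z ::ₛ Sym.nil

/-- The class of all finite complete structures that embed no triangle of `S`. -/
def Forb (S : Set (Sym ι 3)) : Set (Bundled.{w} (colourLanguage ι).Structure) :=
  {N | Finite N ∧ IsComplete ι N ∧
    ∀ (a b c : N) (x y z : ι), Col x a b → Col y b c → Col z a c → tri x y z ∉ S}

/-- `K` is a semi-free amalgamation class, with `L'` as a set of solutions. -/
structure IsSemiFreeAmalgamationClass (K : Set (Bundled.{w} (colourLanguage ι).Structure))
    (L' : Set ι) : Prop where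
  isFraisse : FirstOrder.Language.IsFraisse K
  proper : L' ⊂ Set.univ
  amalgam : ∀ A B C : Bundled.{w} (colourLanguage ι).Structure, A ∈ K → B ∈ K → C ∈ K →
    ∀ (f₁ : B ↪[colourLanguage ι] A) (f₂ : B ↪[colourLanguage ι] C),
      ∃ D ∈ K, ∃ (g₁ : A ↪[colourLanguage ι] D) (g₂ : C ↪[colourLanguage ι] D),
        g₁.comp f₁ = g₂.comp f₂ ∧
        Set.range g₁ ∩ Set.range g₂ = Set.range (g₁.comp f₁) ∧
        ∀ a ∈ Set.range g₁ \ Set.range (g₁.comp f₁), ∀ c ∈ Set.range g₂ \ Set.range (g₁.comp f₁),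
          ∀ x : ι, Col x a c → x ∈ L'

/-- Colouring the pair `(a, c)` by `z` creates no forbidden triangle `abc` with `b ∈ B`. -/
def Admissible (S : Set (Sym ι 3)) {D : Type w} [(colourLanguage ι).Structure D]
    (B : Set D) (a c : D) (z : ι) : Prop :=
  ∀ b ∈ B, ∀ x y : ι, Col x a b → Col y b c → tri x y z ∉ S

/-- For subsets `A`, `B`, `C` of a structure `D`: the substructure on `A ∪ C` is `A ⊗_B C`, i.e.
`A ∩ C = B` and each pair `a ∈ A \ B`, `c ∈ C \ B` has the colour `R i` with `i` least such that
`R i` is admissible for `(a, c)` over `B`. The order on the colours is `R 0 > R 1 > ⋯`. -/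
def IsPriorityAmalgam (S : Set (Sym ι 3)) {m : ℕ} (R : Fin m → ι)
    {D : Type w} [(colourLanguage ι).Structure D] (A B C : Set D) : Prop :=
  A ∩ C = B ∧ ∀ a ∈ A \ B, ∀ c ∈ C \ B, ∃ i : Fin m,
    Col (R i) a c ∧ Admissible S B a c (R i) ∧ ∀ j < i, ¬ Admissible S B a c (R j)

/-- `Forb S` is a prioritised semi-free amalgamation class with respect to `R 0 > R 1 > ⋯`:
for all `A, B, C` in `Forb S` with `B` embedded in `A` and `C`, the structure `A ⊗_B C`
belongs to `Forb S`. -/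
def IsPrioritisedClass (S : Set (Sym ι 3)) {m : ℕ} (R : Fin m → ι) : Prop :=
  ∀ A B C : Bundled.{w} (colourLanguage ι).Structure, A ∈ Forb S → B ∈ Forb S → C ∈ Forb S →
    ∀ (f₁ : B ↪[colourLanguage ι] A) (f₂ : B ↪[colourLanguage ι] C),
      ∃ D ∈ Forb.{u, w} S,
        ∃ (g₁ : A ↪[colourLanguage ι] D) (g₂ : C ↪[colourLanguage ι] D),
          g₁.comp f₁ = g₂.comp f₂ ∧
          Set.range g₁ ∪ Set.range g₂ = Set.univ ∧
          IsPriorityAmalgam S R (Set.range g₁) (Set.range (g₁.comp f₁)) (Set.range g₂)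

/-- `S` contains no triangle with two sides from `L' = {R 0, …, R (m - 1)}`. -/
def Condition1 (S : Set (Sym ι 3)) {m : ℕ} (R : Fin m → ι) : Prop :=
  ∀ (i j : Fin m) (x : ι), tri (R i) (R j) x ∉ S

/-- The triangles prescribed by the second condition, with `Ls` for `L⋆` and `Lh` for `L̂`. -/
def Prescribed (R₂ : ι) (Ls Lh : Set ι) : Set (Sym ι 3) :=
  {t | (∃ x y z, x ∉ Lh ∧ x ≠ R₂ ∧ y ∈ Ls ∧ z ∈ Ls ∧ t = tri x y z) ∨
       (∃ y ∈ Ls, t = tri R₂ R₂ y) ∨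
       (∃ x ∈ Lh, ∃ y ∈ Ls, t = tri R₂ x y)}

/-- The second condition, for `L' = {R₁, R₂}` with `R₁ > R₂`. -/
def Condition2 (S : Set (Sym ι 3)) (R₁ R₂ : ι) : Prop :=
  ∃ Ls Lh : Set ι, Disjoint Ls {R₁, R₂} ∧ Disjoint Lh ({R₁, R₂} ∪ Ls) ∧
    Prescribed R₂ Ls Lh ⊆ S ∧
    ∀ t ∈ S, (R₁ ∈ t ∨ ∃ x, t = tri R₂ R₂ x) → t ∈ Prescribed R₂ Ls Lh

section Limit

variable {M : Type w} [(colourLanguage ι).Structure M]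

/-- The automorphism group, with composition as multiplication. -/
instance autGroup : Group (M ≃[colourLanguage ι] M) where
  mul g h := g.comp h
  one := FirstOrder.Language.Equiv.refl _ M
  inv g := g.symm
  mul_assoc _ _ _ := FirstOrder.Language.Equiv.ext fun _ => rfl
  one_mul _ := FirstOrder.Language.Equiv.ext fun _ => rfl
  mul_one _ := FirstOrder.Language.Equiv.ext fun _ => rfl
  inv_mul_cancel g := g.symm_comp_self

/-- `A ⫝_B C`: the substructure `ABC` of `M` is `AB ⊗_B BC`. -/
def Indep (S : Set (Sym ι 3)) {m : ℕ} (R : Fin m → ι) (A B C : Set M) : Prop :=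
  IsPriorityAmalgam S R (A ∪ B) B (B ∪ C)

variable (M) in
/-- The main condition on `S`, with `M` in the role of the Fraïssé limit: `S` contains no triangle
with two sides `R₁R₁` or `R₁R₂` (the latter if there is an `R₂`), and `a ⫝_{bB} c` implies
`a ⫝_B c` whenever `b ≠ c` and the colour of `(a, b)` is in `L'`. -/
structure MainCondition (S : Set (Sym ι 3)) {m : ℕ} (R : Fin m → ι) : Prop where
  noTriangle : ∀ (i j : Fin m) (x : ι), (i : ℕ) = 0 → (j : ℕ) ≤ 1 → tri (R i) (R j) x ∉ S
  indep : ∀ (a b c : M) (B : Set M), B.Finite → b ≠ c → (∃ i, Col (R i) a b) →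
    Indep S R {a} (insert b B) {c} → Indep S R {a} B {c}

/-- Every 1-type over a finite set `X` (an orbit of the pointwise stabiliser of `X`) has a
realisation `a` with `a ⫝_X g a`. -/
def MovesAlmostMaximally (S : Set (Sym ι 3)) {m : ℕ} (R : Fin m → ι)
    (g : M ≃[colourLanguage ι] M) : Prop :=
  ∀ X : Set M, X.Finite → ∀ a₀ : M, ∃ a : M,
    (∃ s : M ≃[colourLanguage ι] M, (∀ x ∈ X, s x = x) ∧ s a₀ = a) ∧ Indep S R {a} X {g a}

/-- The commutator `[h, g] = h⁻¹g⁻¹hg`. -/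
def comm (h g : M ≃[colourLanguage ι] M) : M ≃[colourLanguage ι] M := h⁻¹ * g⁻¹ * h * g

end Limit

end SemiFree

/-! The conditions on `S` are used in two ways. First, no triangle of `S` has two sides in `L'`,
except possibly with both sides equal to the last solution (`GoodColours`). Second, colours picked
by the priority rule never complete a forbidden triangle with two cross edges (`tri_chosen_notMem`).
Hence any semi-free amalgam may be recoloured by the rule without leaving the class, which gives the
prioritised class.

Suppose `a` and `c` are independent over `bB`, with colour `R i`, and `r(a,b)` is a solution. A
preferred `R j`, `j < i`, was not rejected because of `b`: that triangle would have the sides `R j`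
and `r(a,b)`, two solutions of which the first is not the last one. So `b` can be dropped from the
base (`Ind.of_insert`), which is the main condition. Dropping points one at a time yields
transitivity (`Ind.trans`). Together with existence and stationarity (`Ind.edge_eq`), this makes the
method of Tent and Ziegler applicable.

A non-trivial `g` moves some realisation of each non-algebraic type (`Tame.exists_moved`). By
back-and-forth, `h` is built so that `[h,g]` sends a realisation `a` of each such type to a point
independent from `a` over `g a` and a finite set of points independent from `a`
(`Tame.exists_commGeneric`). The first commutator thus joins `a` to its image by a solution. In the
second commutator the base point `g a` is joined to `a` by a solution, hence can be dropped, and the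
map moves almost maximally.

If `g` moves almost maximally, consider products of four conjugates of `g` and `g⁻¹`, arranged as
two halves that meet in the middle. When the end points of each half are independent over its middle
points, any finite partial specification of the product consistent with the present one can be met
without disturbing the paths already fixed (`Tame.fill`), and independence can be restored on a
larger set (`Tame.restore`). A back-and-forth between two such products `U` and `V` with `U = V f`
writes an arbitrary `f` as `V⁻¹ U`, a product of eight conjugates (`Tame.exists_words`). Simplicity
follows, since commutators with `g` lie in its normal closure. -/

namespace SemiFree

/-! ### Unordered triples of colours -/

section Triangles

variable {ι : Type u}

lemma tri_swap_left (x y z : ι) : tri x y z = tri y x z := Sym.cons_swap _ _ _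

lemma tri_swap_right (x y z : ι) : tri x y z = tri x z y := by
  unfold tri; rw [Sym.cons_swap y z]

lemma tri_rotate (x y z : ι) : tri x y z = tri y z x := by
  rw [tri_swap_left, tri_swap_right]

lemma mem_tri {t x y z : ι} : t ∈ tri x y z ↔ t = x ∨ t = y ∨ t = z := by
  simp [tri]

lemma pair_eq_of_tri_eq {x y z q r : ι} (h : tri x y z = tri x q r) :
    y = q ∧ z = r ∨ y = r ∧ z = q := by
  have h1 : (y ::ₛ z ::ₛ Sym.nil : Sym ι 2) = q ::ₛ r ::ₛ Sym.nil := (Sym.cons_inj_right _ _ _).1 h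
  have hy : y ∈ (q ::ₛ r ::ₛ Sym.nil : Sym ι 2) := h1 ▸ Sym.mem_cons_self _ _
  simp only [Sym.mem_cons, Sym.notMem_nil, or_false] at hy
  rcases hy with rfl | rfl
  · exact Or.inl ⟨rfl, by simpa using h1⟩
  · rw [Sym.cons_swap q y] at h1
    exact Or.inr ⟨rfl, by simpa using h1⟩

lemma cases_of_tri_eq {x y z p q r : ι} (h : tri x y z = tri p q r) :
    x = p ∧ (y = q ∧ z = r ∨ y = r ∧ z = q) ∨ x = q ∧ (y = p ∧ z = r ∨ y = r ∧ z = p) ∨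
      x = r ∧ (y = p ∧ z = q ∨ y = q ∧ z = p) := by
  have hx : x ∈ tri p q r := h ▸ Sym.mem_cons_self _ _
  rcases mem_tri.1 hx with rfl | rfl | rfl
  · exact Or.inl ⟨rfl, pair_eq_of_tri_eq h⟩
  · rw [tri_swap_left p] at h
    exact Or.inr (Or.inl ⟨rfl, pair_eq_of_tri_eq h⟩)
  · rw [← tri_rotate x p q] at h
    exact Or.inr (Or.inr ⟨rfl, pair_eq_of_tri_eq h⟩)

end Triangles

/-! ### Admissible colours and the priority rule -/

section Colours

variable {ι : Type u} {S : Set (Sym ι 3)} {m : ℕ} {R : Fin m → ι}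

/-- No triangle of a structure belongs to `S`. -/
def OmitsTriangles (S : Set (Sym ι 3)) (N : Type w) [(colourLanguage ι).Structure N] : Prop :=
  ∀ (a b c : N) (x y z : ι), Col x a b → Col y b c → Col z a c → tri x y z ∉ S

/-- The index `i` is least such that `R i` is admissible for `(a, c)` over `B`. -/
def Chosen (S : Set (Sym ι 3)) (R : Fin m → ι) {D : Type w} [(colourLanguage ι).Structure D]
    (B : Set D) (a c : D) (i : Fin m) : Prop :=
  Admissible S B a c (R i) ∧ ∀ j < i, ¬ Admissible S B a c (R j)

/-- The two combinatorial conditions on colours from which everything else is derived. -/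
structure GoodColours (S : Set (Sym ι 3)) (R : Fin m → ι) : Prop where
  first : ∀ (i j : Fin m) (z : ι), (i : ℕ) = 0 → tri (R i) (R j) z ∉ S
  notLast : ∀ (i j k : Fin m) (z : ι), i < k → tri (R i) (R j) z ∉ S

section

variable {N : Type w} [(colourLanguage ι).Structure N]

lemma Chosen.unique {B : Set N} {a c : N} {i j : Fin m}
    (hi : Chosen S R B a c i) (hj : Chosen S R B a c j) : i = j := by
  rcases lt_trichotomy i j with h | h | h
  · exact absurd hi.1 (hj.2 i h)
  · exact h
  · exact absurd hj.1 (hi.2 j h)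

lemma exists_chosen {B : Set N} {a c : N} (h : ∃ i, Admissible S B a c (R i)) :
    ∃ i, Chosen S R B a c i := by
  classical
  obtain ⟨i, hi⟩ := h
  induction i using WellFoundedLT.induction with
  | ind i ih =>
    by_cases hj : ∃ j < i, Admissible S B a c (R j)
    · obtain ⟨j, hj, hj'⟩ := hj
      exact ih j hj hj'
    · push Not at hj
      exact ⟨i, hi, hj⟩

lemma admissible_comm (hN : IsComplete ι N) {B : Set N} {a c : N} {z : ι} :
    Admissible S B a c z ↔ Admissible S B c a z := by
  constructor <;> intro h b hb x y hx hy <;> rw [tri_swap_left] <;>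
    exact h b hb y x (hN.symm _ _ _ hy) (hN.symm _ _ _ hx)

lemma chosen_comm (hN : IsComplete ι N) {B : Set N} {a c : N} {i : Fin m} :
    Chosen S R B a c i ↔ Chosen S R B c a i := by
  simp only [Chosen, admissible_comm hN (a := a)]

lemma OmitsTriangles.admissible (hS : OmitsTriangles S N) {B : Set N} {a c : N} {z : ι}
    (h : Col z a c) : Admissible S B a c z :=
  fun b _ x y hx hy => hS a b c x y z hx hy h

end

end Colours

/-! ### Colour combinatorics of the two conditions -/

section Conditions

variable {ι : Type u} {S : Set (Sym ι 3)}

lemma Condition1.goodColours {m : ℕ} {R : Fin m → ι} (h : Condition1 S R) : GoodColours S R :=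
  ⟨fun i j z _ => h i j z, fun i j _ z _ => h i j z⟩

/-- The triangles of `S` that involve the first colour of the second condition. -/
lemma Condition2.mem_of_first {R₁ R₂ : ι} {Ls Lh : Set ι} (hd : Disjoint Ls {R₁, R₂})
    (h12 : R₁ ≠ R₂) (h : ∀ t ∈ S, (R₁ ∈ t ∨ ∃ x, t = tri R₂ R₂ x) → t ∈ Prescribed R₂ Ls Lh)
    (hd' : Disjoint Lh ({R₁, R₂} ∪ Ls)) {x y : ι} (ht : tri R₁ x y ∈ S) : x ∈ Ls ∧ y ∈ Ls := by
  have h1 : R₁ ∉ Ls := fun h => Set.disjoint_left.1 hd h (by simp)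
  have h3 : R₁ ∉ Lh := fun h => Set.disjoint_left.1 hd' h (by simp)
  rcases h _ ht (Or.inl (by simp [mem_tri])) with
    ⟨p, q, r, -, -, hq, hr, he⟩ | ⟨q, hq, he⟩ | ⟨p, hp, q, hq, he⟩
  · have := cases_of_tri_eq he
    rcases this with ⟨-, ⟨rfl, rfl⟩ | ⟨rfl, rfl⟩⟩ | ⟨rfl, -⟩ | ⟨rfl, -⟩
    · exact ⟨hq, hr⟩
    · exact ⟨hr, hq⟩
    · exact absurd hq h1
    · exact absurd hr h1
  · have : R₁ ∈ tri R₂ R₂ q := he ▸ Sym.mem_cons_self _ _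
    rcases mem_tri.1 this with rfl | rfl | rfl
    · exact absurd rfl h12
    · exact absurd rfl h12
    · exact absurd hq h1
  · have : R₁ ∈ tri R₂ p q := he ▸ Sym.mem_cons_self _ _
    rcases mem_tri.1 this with rfl | rfl | rfl
    · exact absurd rfl h12
    · exact absurd hp h3
    · exact absurd hq h1

/-- The triangles of `S` that involve the second colour of the second condition twice. -/
lemma Condition2.mem_of_second {R₁ R₂ : ι} {Ls Lh : Set ι} (hd : Disjoint Ls {R₁, R₂})
    (h : ∀ t ∈ S, (R₁ ∈ t ∨ ∃ x, t = tri R₂ R₂ x) → t ∈ Prescribed R₂ Ls Lh)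
    (hd' : Disjoint Lh ({R₁, R₂} ∪ Ls)) {z : ι} (ht : tri R₂ R₂ z ∈ S) : z ∈ Ls := by
  have h1 : R₂ ∉ Ls := fun h => Set.disjoint_left.1 hd h (by simp)
  have h3 : R₂ ∉ Lh := fun h => Set.disjoint_left.1 hd' h (by simp)
  rcases h _ ht (Or.inr ⟨z, rfl⟩) with
    ⟨p, q, r, -, -, hq, hr, he⟩ | ⟨q, hq, he⟩ | ⟨p, hp, q, hq, he⟩
  · rcases cases_of_tri_eq he with ⟨-, ⟨rfl, rfl⟩ | ⟨rfl, rfl⟩⟩ | ⟨rfl, -⟩ | ⟨rfl, -⟩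
    · exact hr
    · exact hq
    · exact absurd hq h1
    · exact absurd hr h1
  · rcases pair_eq_of_tri_eq he with ⟨-, rfl⟩ | ⟨rfl, rfl⟩
    · exact hq
    · exact hq
  · rcases pair_eq_of_tri_eq he with ⟨rfl, rfl⟩ | ⟨rfl, rfl⟩
    · exact hq
    · exact absurd hq h1

variable {m : ℕ} {R : Fin m → ι}

/-- The first condition, or the second one for two solutions. -/
def EitherCondition (S : Set (Sym ι 3)) (R : Fin m → ι) : Prop :=
  Condition1 S R ∨ ∃ h : m = 2, Condition2 S (R (Fin.cast h.symm 0)) (R (Fin.cast h.symm 1))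

lemma goodColours_of_condition (hR : Function.Injective R)
    (hcond : EitherCondition S R) :
    GoodColours S R := by
  rcases hcond with h | ⟨rfl, h2⟩
  · exact h.goodColours
  obtain ⟨Ls, Lh, hd, hd', -, h⟩ : Condition2 S (R 0) (R 1) := h2
  have h12 : R 0 ≠ R 1 := fun h => by simpa using hR h
  have key : ∀ (j : Fin 2) (z : ι), tri (R 0) (R j) z ∉ S := by
    intro j z hz
    have := (Condition2.mem_of_first hd h12 h hd' hz).1
    refine Set.disjoint_left.1 hd this ?_
    fin_cases j <;> simp
  refine ⟨fun i j z hi => ?_, fun i j k z hi => ?_⟩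
  · have h0 : i = 0 := Fin.ext hi
    exact h0 ▸ key j z
  · have h0 : i = 0 := by omega
    exact h0 ▸ key j z

variable {N : Type w} [(colourLanguage ι).Structure N]

/-- Choosing colours by priority creates no forbidden triangle with two cross edges. -/
lemma tri_chosen_notMem (hR : Function.Injective R)
    (hcond : EitherCondition S R)
    (hN : IsComplete ι N) (hS : OmitsTriangles S N) {B : Set N} {a a' c : N} {i j : Fin m} {z : ι}
    (ha' : a' ∉ B) (hi : Chosen S R B a c i) (hj : Chosen S R B a' c j) (hz : Col z a a') :
    tri (R i) (R j) z ∉ S := by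
  have hgood := goodColours_of_condition hR hcond
  rcases hcond with h | ⟨rfl, h2⟩
  · exact h i j z
  obtain ⟨Ls, Lh, hd, hd', hP, h⟩ : Condition2 S (R 0) (R 1) := h2
  have h12 : R 0 ≠ R 1 := fun h => by simpa using hR h
  intro ht
  have hi1 : i = 1 := by
    by_contra hne
    exact hgood.notLast i j 1 z (by omega) ht
  have hj1 : j = 1 := by
    by_contra hne
    rw [tri_swap_left] at ht
    exact hgood.notLast j i 1 z (by omega) ht
  subst hi1 hj1
  -- Both cross edges have the second colour, so `z` lies in `L⋆`. A point `b` that rejects the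
  -- first colour for `(a, c)` sees both with colours in `L⋆`. Each possible colour `v` of `(a', b)`
  -- is then excluded: if `v` is the second colour or lies in `L̂`, then `b` rejects the second
  -- colour for `(a', c)`; otherwise `a' a b` is itself forbidden.
  have hzs := Condition2.mem_of_second hd h hd' ht
  have := hi.2 0 (by simp)
  simp only [Admissible, not_forall, not_not] at this
  obtain ⟨b, hb, x, y, hx, hy, hxy⟩ := this
  rw [← tri_rotate] at hxy
  obtain ⟨hxs, hys⟩ := Condition2.mem_of_first hd h12 h hd' hxy
  obtain ⟨v, hv, -⟩ := hN.existsUnique a' b (fun h => ha' (h ▸ hb))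
  have hadm := hj.1 b hb v y hv hy
  by_cases hv2 : v = R 1
  · subst hv2
    apply hadm
    rw [tri_swap_right]
    exact hP (Or.inr (Or.inl ⟨y, hys, rfl⟩))
  by_cases hvh : v ∈ Lh
  · apply hadm
    rw [← tri_rotate]
    exact hP (Or.inr (Or.inr ⟨v, hvh, y, hys, rfl⟩))
  · refine hS a' a b z x v (hN.symm _ _ _ hz) hx hv ?_
    rw [← tri_rotate]
    exact hP (Or.inl ⟨v, z, x, hvh, hv2, hzs, hxs, rfl⟩)

end Conditions

/-! ### Structures and embeddings given by colours -/

section Structures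

variable {ι : Type u}

/-- The structure whose relations are given by `c`. -/
abbrev structureOf {N : Type w} (c : ι → N → N → Prop) : (colourLanguage ι).Structure N where
  funMap f := nomatch f
  RelMap := fun r v => match r, v with
    | ColourRel.rel x, v => c x (v 0) (v 1)

section

variable {M N : Type*} [(colourLanguage ι).Structure M] [(colourLanguage ι).Structure N]

/-- An injection that preserves all colours, as an embedding. -/
def embeddingOf (f : M → N) (hf : Function.Injective f)
    (h : ∀ (x : ι) (a b : M), Col x (f a) (f b) ↔ Col x a b) : M ↪[colourLanguage ι] N where
  toFun := f
  inj' := hf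
  map_fun' g := nomatch g
  map_rel' := by
    rintro n ⟨x⟩ v
    have h1 : f ∘ v = ![f (v 0), f (v 1)] := by ext i; fin_cases i <;> rfl
    have h2 : v = ![v 0, v 1] := by ext i; fin_cases i <;> rfl
    rw [h1]
    nth_rw 3 [h2]
    exact h x (v 0) (v 1)

lemma col_embedding (f : M ↪[colourLanguage ι] N) {x : ι} {a b : M} :
    Col x (f a) (f b) ↔ Col x a b := by
  have := f.map_rel (ColourRel.rel x) ![a, b]
  have h1 : f ∘ ![a, b] = ![f a, f b] := by ext i; fin_cases i <;> rfl
  rw [h1] at this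
  exact this

lemma col_equiv (f : M ≃[colourLanguage ι] N) {x : ι} {a b : M} :
    Col x (f a) (f b) ↔ Col x a b := col_embedding f.toEmbedding

end

end Structures

/-! ### Recolouring a semi-free amalgam by priority -/

section Recolour

variable {ι : Type u} {S : Set (Sym ι 3)} {m : ℕ} {R : Fin m → ι}
variable {N : Type w} [(colourLanguage ι).Structure N]

/-- The pair `(u, v)` has one point in `A \ B` and one in `C \ B`. -/
def Cross (A B C : Set N) (u v : N) : Prop :=
  u ∈ A \ B ∧ v ∈ C \ B ∨ u ∈ C \ B ∧ v ∈ A \ B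

lemma Cross.symm {A B C : Set N} {u v : N} (h : Cross A B C u v) : Cross A B C v u :=
  Or.symm (h.imp And.symm And.symm)

/-- The colours of the priority amalgam on `A ∪ C`, given some amalgam on the same set. -/
def recol (S : Set (Sym ι 3)) (R : Fin m → ι) (A B C : Set N) (x : ι) (u v : N) : Prop :=
  Cross A B C u v ∧ (∃ i, Chosen S R B u v i ∧ x = R i) ∨ ¬ Cross A B C u v ∧ Col x u v

variable {A B C : Set N}

lemma recol_of_cross {x : ι} {u v : N} (h : Cross A B C u v) :
    recol S R A B C x u v ↔ ∃ i, Chosen S R B u v i ∧ x = R i := by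
  simp [recol, h]

lemma recol_of_not_cross {x : ι} {u v : N} (h : ¬ Cross A B C u v) :
    recol S R A B C x u v ↔ Col x u v := by
  simp [recol, h]

lemma recol_symm (hN : IsComplete ι N) {x : ι} {u v : N} (h : recol S R A B C x u v) :
    recol S R A B C x v u := by
  by_cases hc : Cross A B C u v
  · rw [recol_of_cross hc] at h
    rw [recol_of_cross hc.symm]
    simpa only [chosen_comm hN (a := v)] using h
  · rw [recol_of_not_cross hc] at h
    rw [recol_of_not_cross (fun h => hc h.symm)]
    exact hN.symm _ _ _ h

lemma not_cross_left (hAC : A ∩ C = B) {u v : N} (hu : u ∈ A) (hv : v ∈ A) :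
    ¬ Cross A B C u v := by
  rintro (⟨-, h, h'⟩ | ⟨⟨h, h'⟩, -⟩)
  · exact h' (hAC ▸ ⟨hv, h⟩)
  · exact h' (hAC ▸ ⟨hu, h⟩)

lemma not_cross_right (hAC : A ∩ C = B) {u v : N} (hu : u ∈ C) (hv : v ∈ C) :
    ¬ Cross A B C u v := by
  rintro (⟨⟨h, h'⟩, -⟩ | ⟨-, h, h'⟩)
  · exact h' (hAC ▸ ⟨h, hu⟩)
  · exact h' (hAC ▸ ⟨h, hv⟩)

/-- If the third point lies in the base, admissibility of the chosen colour applies. Otherwise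
exactly one of the other two edges is a cross edge too, and `tri_chosen_notMem` applies to the two
cross edges, which share a vertex. -/
lemma recol_tri_of_cross (hR : Function.Injective R)
    (hcond : EitherCondition S R)
    (hN : IsComplete ι N) (hS : OmitsTriangles S N) (hAC : A ∩ C = B) {a b c : N}
    (hc : c ∈ A ∪ C) {x y z : ι} (hab : Cross A B C a b) (hx : recol S R A B C x a b)
    (hy : recol S R A B C y b c) (hz : recol S R A B C z a c) : tri x y z ∉ S := by
  obtain ⟨i, hi, rfl⟩ := (recol_of_cross hab).1 hx
  by_cases hcB : c ∈ B
  · rw [recol_of_not_cross] at hy hz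
    · rw [tri_rotate, tri_swap_left]
      exact hi.1 c hcB z y hz (hN.symm _ _ _ hy)
    · rintro (⟨-, h⟩ | ⟨-, h⟩) <;> exact h.2 hcB
    · rintro (⟨-, h⟩ | ⟨-, h⟩) <;> exact h.2 hcB
  have side : Cross A B C a c ∧ ¬ Cross A B C b c ∨ Cross A B C b c ∧ ¬ Cross A B C a c := by
    rcases hab with ⟨ha, hb⟩ | ⟨ha, hb⟩ <;> rcases hc with hc | hc
    · exact Or.inr ⟨Or.inr ⟨hb, hc, hcB⟩, not_cross_left hAC ha.1 hc⟩
    · exact Or.inl ⟨Or.inl ⟨ha, hc, hcB⟩, not_cross_right hAC hb.1 hc⟩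
    · exact Or.inl ⟨Or.inr ⟨ha, hc, hcB⟩, not_cross_left hAC hb.1 hc⟩
    · exact Or.inr ⟨Or.inl ⟨hb, hc, hcB⟩, not_cross_right hAC ha.1 hc⟩
  rcases side with ⟨hac, hbc⟩ | ⟨hbc, hac⟩
  · obtain ⟨j, hj, rfl⟩ := (recol_of_cross hac).1 hz
    rw [recol_of_not_cross hbc] at hy
    rw [tri_swap_right]
    exact tri_chosen_notMem hR hcond hN hS hcB ((chosen_comm hN).1 hi) ((chosen_comm hN).1 hj) hy
  · obtain ⟨j, hj, rfl⟩ := (recol_of_cross hbc).1 hy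
    rw [recol_of_not_cross hac] at hz
    exact tri_chosen_notMem hR hcond hN hS hcB hi ((chosen_comm hN).1 hj) hz

lemma recol_tri (hR : Function.Injective R)
    (hcond : EitherCondition S R)
    (hN : IsComplete ι N) (hS : OmitsTriangles S N) (hAC : A ∩ C = B) {a b c : N}
    (ha : a ∈ A ∪ C) (hb : b ∈ A ∪ C) (hc : c ∈ A ∪ C) {x y z : ι} (hx : recol S R A B C x a b)
    (hy : recol S R A B C y b c) (hz : recol S R A B C z a c) : tri x y z ∉ S := by
  by_cases h1 : Cross A B C a b
  · exact recol_tri_of_cross hR hcond hN hS hAC hc h1 hx hy hz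
  by_cases h2 : Cross A B C b c
  · rw [tri_rotate]
    exact recol_tri_of_cross hR hcond hN hS hAC ha h2 hy (recol_symm hN hz) (recol_symm hN hx)
  by_cases h3 : Cross A B C a c
  · rw [← tri_rotate, tri_swap_right]
    exact recol_tri_of_cross hR hcond hN hS hAC hb h3 hz (recol_symm hN hy) hx
  rw [recol_of_not_cross] at hx hy hz <;> first | assumption | exact hS a b c x y z hx hy hz

end Recolour

section Prioritised

variable {ι : Type u} {S : Set (Sym ι 3)} {m : ℕ} {R : Fin m → ι}

/-- The given semi-free amalgam serves only to show that each cross pair has some admissible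
solution, namely its own colour. The least admissible one then replaces it. -/
theorem isPrioritisedClass (hR : Function.Injective R)
    (hS : IsSemiFreeAmalgamationClass (Forb.{u, w} S) (Set.range R))
    (hcond : EitherCondition S R) :
    IsPrioritisedClass.{u, w} S R := by
  intro A₀ B₀ C₀ hA₀ hB₀ hC₀ f₁ f₂
  obtain ⟨D, ⟨hDfin, hD, hDS⟩, g₁, g₂, hg, hr, hcol⟩ := hS.amalgam A₀ B₀ C₀ hA₀ hB₀ hC₀ f₁ f₂
  set A := Set.range g₁ with hA
  set C := Set.range g₂ with hC
  set B := Set.range (g₁.comp f₁) with hB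
  have hex : ∀ u v, Cross A B C u v → ∃ i, Chosen S R B u v i := by
    have : ∀ u ∈ A \ B, ∀ v ∈ C \ B, ∃ i, Chosen S R B u v i := by
      intro u hu v hv
      obtain ⟨x, hx, -⟩ := hD.existsUnique u v (fun h => hu.2 (hr ▸ ⟨hu.1, h ▸ hv.1⟩))
      obtain ⟨i, rfl⟩ := hcol u hu v hv x hx
      exact exists_chosen ⟨i, OmitsTriangles.admissible hDS hx⟩
    rintro u v (⟨h, h'⟩ | ⟨h, h'⟩)
    · exact this u h v h'
    · simpa only [chosen_comm hD (a := v)] using this v h' u h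
  let N := {x : D // x ∈ A ∪ C}
  let str : (colourLanguage ι).Structure N := structureOf fun x u v => recol S R A B C x u.1 v.1
  have hcolN : ∀ (x : ι) (u v : N), Col x u v ↔ recol S R A B C x u.1 v.1 := fun _ _ _ => Iff.rfl
  have hN : IsComplete ι N := by
    refine ⟨fun x u h => ?_, fun x u v h => recol_symm hD h, fun u v huv => ?_⟩
    · rw [hcolN, recol_of_not_cross] at h
      · exact hD.irrefl _ _ h
      · rintro (⟨h1, h2⟩ | ⟨h1, h2⟩)
        · exact h1.2 (hr ▸ ⟨h1.1, h2.1⟩)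
        · exact h1.2 (hr ▸ ⟨h2.1, h1.1⟩)
    · simp only [hcolN]
      by_cases hc : Cross A B C u.1 v.1
      · simp only [recol_of_cross hc]
        obtain ⟨i, hi⟩ := hex _ _ hc
        exact ⟨R i, ⟨i, hi, rfl⟩, by rintro y ⟨j, hj, rfl⟩; rw [hi.unique hj]⟩
      · simp only [recol_of_not_cross hc]
        exact hD.existsUnique _ _ (fun h => huv (Subtype.ext h))
  let e₁ : A₀ ↪[colourLanguage ι] N := embeddingOf (fun a => ⟨g₁ a, Or.inl ⟨a, rfl⟩⟩)
    (fun a b h => g₁.injective (congrArg Subtype.val h)) (fun x a b => by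
      rw [hcolN, recol_of_not_cross (not_cross_left hr ⟨a, rfl⟩ ⟨b, rfl⟩)]
      exact col_embedding g₁)
  let e₂ : C₀ ↪[colourLanguage ι] N := embeddingOf (fun a => ⟨g₂ a, Or.inr ⟨a, rfl⟩⟩)
    (fun a b h => g₂.injective (congrArg Subtype.val h)) (fun x a b => by
      rw [hcolN, recol_of_not_cross (not_cross_right hr ⟨a, rfl⟩ ⟨b, rfl⟩)]
      exact col_embedding g₂)
  have hr₁ : ∀ u : N, u ∈ Set.range e₁ ↔ u.1 ∈ A := fun u =>
    ⟨by rintro ⟨a, rfl⟩; exact ⟨a, rfl⟩, by rintro ⟨a, h⟩; exact ⟨a, Subtype.ext h⟩⟩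
  have hr₂ : ∀ u : N, u ∈ Set.range e₂ ↔ u.1 ∈ C := fun u =>
    ⟨by rintro ⟨a, rfl⟩; exact ⟨a, rfl⟩, by rintro ⟨a, h⟩; exact ⟨a, Subtype.ext h⟩⟩
  have hrB : ∀ u : N, u ∈ Set.range (e₁.comp f₁) ↔ u.1 ∈ B := fun u =>
    ⟨by rintro ⟨a, rfl⟩; exact ⟨a, rfl⟩, by rintro ⟨a, h⟩; exact ⟨a, Subtype.ext h⟩⟩
  have hinter : Set.range e₁ ∩ Set.range e₂ = Set.range (e₁.comp f₁) := by
    ext u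
    rw [Set.mem_inter_iff, hr₁, hr₂, hrB, ← hr]
    rfl
  have hunion : Set.range e₁ ∪ Set.range e₂ = Set.univ := by
    ext u
    simp only [Set.mem_union, Set.mem_univ, iff_true]
    exact u.2.imp (hr₁ u).2 (hr₂ u).2
  have hcomp : e₁.comp f₁ = e₂.comp f₂ := by
    ext b
    exact DFunLike.congr_fun hg b
  have hprio : IsPriorityAmalgam S R (Set.range e₁) (Set.range (e₁.comp f₁)) (Set.range e₂) := by
    refine ⟨hinter, ?_⟩
    rintro u ⟨hu, huB⟩ v ⟨hv, hvB⟩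
    rw [hr₁] at hu
    rw [hr₂] at hv
    rw [hrB] at huB hvB
    have hc : Cross A B C u.1 v.1 := Or.inl ⟨⟨hu, huB⟩, hv, hvB⟩
    obtain ⟨i, hi⟩ := hex _ _ hc
    have hadm : ∀ z, Admissible S (Set.range (e₁.comp f₁)) u v z ↔ Admissible S B u.1 v.1 z := by
      intro z
      have hin : ∀ b : N, b.1 ∈ B → b.1 ∈ A ∧ b.1 ∈ C := fun b hb => by
        rwa [← hr] at hb
      have h1 : ∀ (x : ι) (b : N), b.1 ∈ B → (Col x u b ↔ Col x u.1 b.1) := fun x b hb => by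
        rw [hcolN, recol_of_not_cross (not_cross_left hr hu (hin b hb).1)]
      have h2 : ∀ (x : ι) (b : N), b.1 ∈ B → (Col x b v ↔ Col x b.1 v.1) := fun x b hb => by
        rw [hcolN, recol_of_not_cross (not_cross_right hr (hin b hb).2 hv)]
      constructor
      · intro h b hb x y hx hy
        have hbA : b ∈ A ∪ C := Or.inl ((hr ▸ hb : b ∈ A ∩ C).1)
        exact h ⟨b, hbA⟩ ((hrB _).2 hb) x y ((h1 x ⟨b, hbA⟩ hb).2 hx) ((h2 y ⟨b, hbA⟩ hb).2 hy)
      · intro h b hb x y hx hy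
        have hb := (hrB b).1 hb
        exact h b.1 hb x y ((h1 x b hb).1 hx) ((h2 y b hb).1 hy)
    refine ⟨i, (recol_of_cross hc).2 ⟨i, hi, rfl⟩, (hadm _).2 hi.1, fun j hj => ?_⟩
    rw [hadm]
    exact hi.2 j hj
  exact ⟨Bundled.of N, ⟨inferInstanceAs (Finite N), hN, fun a b c x y z hx hy hz =>
    recol_tri hR hcond hD hDS hr a.2 b.2 c.2 hx hy hz⟩, e₁, e₂, hcomp, hunion, hprio⟩

end Prioritised

/-! ### Colours of pairs as a function -/

section Edge

variable {ι : Type u} {M : Type w} [(colourLanguage ι).Structure M]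

open Classical in
/-- The colour of the pair `(a, b)`, if there is one. -/
noncomputable def edge (ι : Type u) {M : Type w} [(colourLanguage ι).Structure M] (a b : M) :
    Option ι :=
  if h : ∃ x : ι, Col x a b then some h.choose else none

lemma edge_eq_some (hM : IsComplete ι M) {x : ι} {a b : M} : edge ι a b = some x ↔ Col x a b := by
  constructor
  · intro h
    by_cases hx : ∃ x : ι, Col x a b
    · rw [edge, dif_pos hx, Option.some_inj] at h
      exact h ▸ hx.choose_spec
    · rw [edge, dif_neg hx] at h
      simp at h
  · intro h
    have hx : ∃ x : ι, Col x a b := ⟨x, h⟩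
    have hab : a ≠ b := by rintro rfl; exact hM.irrefl _ _ h
    rw [edge, dif_pos hx, Option.some_inj]
    exact (hM.existsUnique a b hab).unique hx.choose_spec h

lemma edge_eq_none (hM : IsComplete ι M) {a b : M} : edge ι a b = none ↔ a = b := by
  constructor
  · intro h
    by_contra hab
    obtain ⟨x, hx, -⟩ := hM.existsUnique a b hab
    rw [(edge_eq_some hM).2 hx] at h
    simp at h
  · rintro rfl
    by_contra h
    obtain ⟨x, hx⟩ := Option.ne_none_iff_exists'.1 h
    exact hM.irrefl _ _ ((edge_eq_some hM).1 hx)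

lemma edge_comm (hM : IsComplete ι M) (a b : M) : edge ι a b = edge ι b a := by
  ext x
  simp only [edge_eq_some hM]
  exact ⟨hM.symm _ _ _, hM.symm _ _ _⟩

lemma edge_congr {N : Type*} [(colourLanguage ι).Structure N] (hM : IsComplete ι M)
    (hN : IsComplete ι N) {a b : M} {a' b' : N} :
    edge ι a b = edge ι a' b' ↔ ∀ x : ι, Col x a b ↔ Col x a' b' := by
  simp only [← edge_eq_some hM, ← edge_eq_some hN]
  exact Option.ext_iff

lemma edge_embedding {N : Type*} [(colourLanguage ι).Structure N] (hM : IsComplete ι M)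
    (hN : IsComplete ι N) (f : M ↪[colourLanguage ι] N) (a b : M) :
    edge ι (f a) (f b) = edge ι a b :=
  (edge_congr hN hM).2 fun _ => col_embedding f

lemma edge_aut (hM : IsComplete ι M) (f : M ≃[colourLanguage ι] M) (a b : M) :
    edge ι (f a) (f b) = edge ι a b :=
  edge_embedding hM hM f.toEmbedding a b

end Edge

/-! ### Homogeneity, extension and existence in the Fraïssé limit -/

section Limit

variable {ι : Type u} {S : Set (Sym ι 3)} {m : ℕ} {R : Fin m → ι}
variable {M : Type w} [(colourLanguage ι).Structure M]

/-- The point `a` is independent from the point `c` over `B`. -/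
def Ind (S : Set (Sym ι 3)) (R : Fin m → ι) (B : Set M) (a c : M) : Prop :=
  a ∈ B ∨ c ∈ B ∨ ∃ i, Col (R i) a c ∧ Chosen S R B a c i

/-- The substructure on a set. -/
def substructureOf (X : Set M) : (colourLanguage ι).Substructure M where
  carrier := X
  fun_mem f := nomatch f

lemma col_substructureOf {X : Set M} {x : ι} {a b : substructureOf (ι := ι) X} :
    Col x a b ↔ Col x a.1 b.1 :=
  (col_embedding (substructureOf (ι := ι) X).subtype).symm

lemma admissible_image {N : Type*} [(colourLanguage ι).Structure N] (φ : N ↪[colourLanguage ι] M)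
    {B : Set N} {a c : N} {z : ι} :
    Admissible S (φ '' B) (φ a) (φ c) z ↔ Admissible S B a c z := by
  simp only [Admissible, Set.forall_mem_image, col_embedding]

lemma chosen_image {N : Type*} [(colourLanguage ι).Structure N] (φ : N ↪[colourLanguage ι] M)
    {B : Set N} {a c : N} {i : Fin m} :
    Chosen S R (φ '' B) (φ a) (φ c) i ↔ Chosen S R B a c i := by
  simp only [Chosen, admissible_image]

/-- The properties of the Fraïssé limit that the argument uses. -/
structure Rich (S : Set (Sym ι 3)) (R : Fin m → ι) (M : Type w)
    [(colourLanguage ι).Structure M] : Prop where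
  complete : IsComplete ι M
  omits : OmitsTriangles S M
  homogeneous : ∀ P : Set (M × M), P.Finite →
    (∀ p ∈ P, ∀ q ∈ P, edge ι p.1 q.1 = edge ι p.2 q.2) →
    ∃ s : M ≃[colourLanguage ι] M, ∀ p ∈ P, s p.1 = p.2
  extension : ∀ Y : Set M, Y.Finite → ∀ t : M → ι,
    (∀ y ∈ Y, ∀ y' ∈ Y, ∀ z : ι, Col z y y' → tri (t y) z (t y') ∉ S) →
    ∃ a ∉ Y, ∀ y ∈ Y, Col (t y) a y
  existence : ∀ X C : Set M, X.Finite → C.Finite → ∀ a : M,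
    ∃ s : M ≃[colourLanguage ι] M, (∀ x ∈ X, s x = x) ∧ ∀ c ∈ C, Ind S R X (s a) c

lemma mem_forb_of_finite [Countable M]
    (hM : FirstOrder.Language.IsFraisseLimit (Forb.{u, w} S) M) {X : Set M} (hX : X.Finite) :
    (⟨substructureOf (ι := ι) X, inferInstance⟩ : Bundled.{w} (colourLanguage ι).Structure) ∈
      Forb.{u, w} S := by
  rw [← hM.age]
  have : Finite (substructureOf (ι := ι) X) := hX
  exact ⟨FirstOrder.Language.Structure.FG.of_finite,
    ⟨(substructureOf (ι := ι) X).subtype⟩⟩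

lemma complete_of_limit [Countable M]
    (hM : FirstOrder.Language.IsFraisseLimit (Forb.{u, w} S) M) : IsComplete ι M := by
  refine ⟨fun x a h => ?_, fun x a b h => ?_, fun a b hab => ?_⟩
  · have := mem_forb_of_finite hM (Set.finite_singleton a)
    exact this.2.1.irrefl x ⟨a, rfl⟩ (col_substructureOf.2 h)
  · have := mem_forb_of_finite hM (Set.toFinite {a, b})
    exact col_substructureOf.1 (this.2.1.symm x ⟨a, Or.inl rfl⟩ ⟨b, Or.inr rfl⟩
      (col_substructureOf.2 h))
  · have := mem_forb_of_finite hM (Set.toFinite {a, b})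
    obtain ⟨x, hx, hu⟩ := this.2.1.existsUnique ⟨a, Or.inl rfl⟩ ⟨b, Or.inr rfl⟩
      (fun h => hab (congrArg Subtype.val h))
    exact ⟨x, col_substructureOf.1 hx, fun y hy => hu y (col_substructureOf.2 hy)⟩

lemma omits_of_limit [Countable M]
    (hM : FirstOrder.Language.IsFraisseLimit (Forb.{u, w} S) M) : OmitsTriangles S M := by
  intro a b c x y z hx hy hz
  have := mem_forb_of_finite hM (Set.toFinite {a, b, c})
  exact this.2.2 ⟨a, Or.inl rfl⟩ ⟨b, Or.inr (Or.inl rfl)⟩ ⟨c, Or.inr (Or.inr rfl)⟩ x y z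
    (col_substructureOf.2 hx) (col_substructureOf.2 hy) (col_substructureOf.2 hz)

lemma homogeneous_of_limit [Countable M]
    (hM : FirstOrder.Language.IsFraisseLimit (Forb.{u, w} S) M) (P : Set (M × M)) (hP : P.Finite)
    (h : ∀ p ∈ P, ∀ q ∈ P, edge ι p.1 q.1 = edge ι p.2 q.2) :
    ∃ s : M ≃[colourLanguage ι] M, ∀ p ∈ P, s p.1 = p.2 := by
  have hc := complete_of_limit hM
  let X : (colourLanguage ι).Substructure M := substructureOf (Prod.fst '' P)
  have hX : X.FG := by
    have : Finite X := hP.image _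
    exact FirstOrder.Language.Substructure.FG.of_finite
  have hex : ∀ x : X, ∃ y, (x.1, y) ∈ P := fun x => by
    obtain ⟨p, hp, hx⟩ := x.2
    exact ⟨p.2, by rwa [← hx]⟩
  choose f hf using hex
  have hedge : ∀ x y : X, edge ι (f x) (f y) = edge ι x.1 y.1 := fun x y =>
    (h _ (hf x) _ (hf y)).symm
  let F : X ↪[colourLanguage ι] M := embeddingOf f
    (fun x y hxy => Subtype.ext ((edge_eq_none hc).1 (by
      rw [← hedge, hxy, (edge_eq_none hc).2 rfl])))
    (fun x a b => ((edge_congr hc hc).1 (hedge a b) x).trans col_substructureOf.symm)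
  obtain ⟨g, hg⟩ := hM.ultrahomogeneous X hX F
  refine ⟨g, fun p hp => ?_⟩
  have h1 : f ⟨p.1, p, hp, rfl⟩ = g p.1 := DFunLike.congr_fun hg ⟨p.1, p, hp, rfl⟩
  rw [← h1]
  apply (edge_eq_none hc).1
  rw [← h _ (hf _) _ hp, (edge_eq_none hc).2 rfl]

lemma exists_embedding_of_limit [Countable M]
    (hM : FirstOrder.Language.IsFraisseLimit (Forb.{u, w} S) M)
    {D : Bundled.{w} (colourLanguage ι).Structure} (hD : D ∈ Forb.{u, w} S) :
    Nonempty (D ↪[colourLanguage ι] M) := by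
  rw [← hM.age] at hD
  exact hD.2

/-- The relations on `Option Y` that extend those on `Y` by the colours `t`. -/
def extendBy {Y : Set M} (t : M → ι) (x : ι) : Option Y → Option Y → Prop
  | none, none => False
  | none, some y => t y = x
  | some y, none => t y = x
  | some y, some y' => Col x y.1 y'.1

/-- The one-point extension of `Y` prescribed by `t` omits `S`, so it embeds in the limit;
homogeneity carries the copy of `Y` back to `Y`. -/
lemma extension_of_limit [Countable M]
    (hM : FirstOrder.Language.IsFraisseLimit (Forb.{u, w} S) M) (Y : Set M) (hY : Y.Finite)
    (t : M → ι) (h : ∀ y ∈ Y, ∀ y' ∈ Y, ∀ z : ι, Col z y y' → tri (t y) z (t y') ∉ S) :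
    ∃ a ∉ Y, ∀ y ∈ Y, Col (t y) a y := by
  have hc := complete_of_limit hM
  have ho := omits_of_limit hM
  let str : (colourLanguage ι).Structure (Option Y) := structureOf (extendBy t)
  have hstr : ∀ (x : ι) (a b : Option Y), Col x a b ↔ extendBy t x a b := fun _ _ _ => Iff.rfl
  have hcN : IsComplete ι (Option Y) := by
    refine ⟨?_, ?_, ?_⟩
    · rintro x (_ | y) h
      · exact h
      · exact hc.irrefl _ _ h
    · rintro x (_ | y) (_ | z) h
      · exact h
      · exact h
      · exact h
      · exact hc.symm _ _ _ h
    · rintro (_ | y) (_ | z) h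
      · exact absurd rfl h
      · exact ⟨t z, rfl, fun x hx => Eq.symm hx⟩
      · exact ⟨t y, rfl, fun x hx => Eq.symm hx⟩
      · exact hc.existsUnique y.1 z.1 (fun h' => h (congrArg some (Subtype.ext h')))
  have hoN : OmitsTriangles S (Option Y) := by
    rintro (_ | a) (_ | b) (_ | c) x y z hx hy hz
    · exact hx.elim
    · exact hx.elim
    · exact hz.elim
    · obtain rfl : t b = x := hx
      obtain rfl : t c = z := hz
      exact h b b.2 c c.2 y hy
    · exact hy.elim
    · obtain rfl : t a = x := hx
      obtain rfl : t c = y := hy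
      rw [tri_swap_right]
      exact h a a.2 c c.2 z hz
    · obtain rfl : t b = y := hy
      obtain rfl : t a = z := hz
      rw [← tri_rotate]
      exact h a a.2 b b.2 x hx
    · exact ho a b c x y z hx hy hz
  have : Finite Y := hY
  have hD : (⟨Option Y, str⟩ : Bundled.{w} (colourLanguage ι).Structure) ∈ Forb.{u, w} S :=
    ⟨inferInstanceAs (Finite (Option Y)), hcN, hoN⟩
  obtain ⟨e'⟩ := exists_embedding_of_limit hM hD
  let e : Option Y ↪[colourLanguage ι] M := e'
  have hP : (Set.range fun y : Y => (e (some y), y.1)).Finite := Set.finite_range _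
  obtain ⟨s, hs⟩ := homogeneous_of_limit hM _ hP (by
    rintro _ ⟨y, rfl⟩ _ ⟨z, rfl⟩
    exact (edge_congr hc hc).2 fun x => col_embedding e)
  have hs : ∀ y : Y, s (e (some y)) = y := fun y => hs _ ⟨y, rfl⟩
  refine ⟨s (e none), fun hmem => ?_, fun y hy => ?_⟩
  · have := hs ⟨_, hmem⟩
    exact Option.some_ne_none _ (e.injective (s.injective this))
  · have := hs ⟨y, hy⟩
    have h1 : Col (t y) (s (e none)) (s (e (some ⟨y, hy⟩))) :=
      (col_equiv s).2 ((col_embedding e).2 ((hstr _ _ _).2 rfl))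
    rwa [this] at h1

/-- The priority amalgam of `X ∪ {a}` and `X ∪ C` over `X` embeds in the limit, and homogeneity puts
its second factor back in place. A further automorphism, fixing `X`, takes `a` to the first factor's
copy of it. -/
lemma existence_of_limit [Countable M] (hprio : IsPrioritisedClass.{u, w} S R)
    (hM : FirstOrder.Language.IsFraisseLimit (Forb.{u, w} S) M) (X C : Set M) (hX : X.Finite)
    (hC : C.Finite) (a : M) :
    ∃ s : M ≃[colourLanguage ι] M, (∀ x ∈ X, s x = x) ∧ ∀ c ∈ C, Ind S R X (s a) c := by
  have hc := complete_of_limit hM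
  let incl : ∀ {Y Z : Set M}, Y ⊆ Z → 
      (substructureOf (ι := ι) Y ↪[colourLanguage ι] substructureOf (ι := ι) Z) :=
    fun h => FirstOrder.Language.Substructure.inclusion h
  have hXa : X ⊆ insert a X := Set.subset_insert _ _
  have hXC : X ⊆ X ∪ C := Set.subset_union_left
  obtain ⟨D, hD, g₁, g₂, hg, -, hinter, hcol⟩ := hprio _ _ _
    (mem_forb_of_finite hM (hX.insert a)) (mem_forb_of_finite hM hX)
    (mem_forb_of_finite hM (hX.union hC)) (incl hXa) (incl hXC)
  obtain ⟨e⟩ := exists_embedding_of_limit hM hD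
  have hP : (Set.range fun y : substructureOf (ι := ι) (X ∪ C) => (e (g₂ y), y.1)).Finite := by
    have : Finite (substructureOf (ι := ι) (X ∪ C)) := hX.union hC
    exact Set.finite_range _
  obtain ⟨s, hs⟩ := homogeneous_of_limit hM _ hP (by
    rintro _ ⟨y, rfl⟩ _ ⟨z, rfl⟩
    exact (edge_congr hc hc).2 fun x =>
      (col_embedding e).trans ((col_embedding g₂).trans col_substructureOf))
  let φ : D ↪[colourLanguage ι] M := s.toEmbedding.comp e
  have hφ₂ : ∀ y (hy : y ∈ X ∪ C), φ (g₂ ⟨y, hy⟩) = y := fun y hy => hs _ ⟨⟨y, hy⟩, rfl⟩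
  have hφ₁ : ∀ x (hx : x ∈ X), φ (g₁ ⟨x, hXa hx⟩) = x := fun x hx => by
    refine Eq.trans ?_ (hφ₂ x (hXC hx))
    exact congrArg φ (DFunLike.congr_fun hg ⟨x, hx⟩)
  obtain ⟨q, hq⟩ := homogeneous_of_limit hM
    (Set.range fun y : substructureOf (ι := ι) (insert a X) => (y.1, φ (g₁ y))) (by
      have : Finite (substructureOf (ι := ι) (insert a X)) := hX.insert a
      exact Set.finite_range _) (by
      rintro _ ⟨y, rfl⟩ _ ⟨z, rfl⟩
      exact (edge_congr hc hc).2 fun x =>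
        ((col_embedding φ).trans ((col_embedding g₁).trans col_substructureOf)).symm)
  have hq : ∀ y (hy : y ∈ insert a X), q y = φ (g₁ ⟨y, hy⟩) := fun y hy => hq _ ⟨⟨y, hy⟩, rfl⟩
  have hqX : ∀ x ∈ X, q x = x := fun x hx => by rw [hq x (hXa hx), hφ₁ x hx]
  refine ⟨q, hqX, fun c hcC => ?_⟩
  by_cases haX : a ∈ X
  · exact Or.inl (by rwa [hqX a haX])
  by_cases hcX : c ∈ X
  · exact Or.inr (Or.inl hcX)
  have hcXC : c ∈ X ∪ C := Or.inr hcC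
  have ha' : a ∈ insert a X := Or.inl rfl
  obtain ⟨i, hi, hi'⟩ := hcol (g₁ ⟨a, ha'⟩) ⟨⟨_, rfl⟩, by
      rintro ⟨x, hx⟩
      have : (x : M) = a := congrArg Subtype.val (g₁.injective hx)
      exact haX (this ▸ x.2)⟩ (g₂ ⟨c, hcXC⟩) ⟨⟨_, rfl⟩, by
      rw [hg]
      rintro ⟨x, hx⟩
      have : (x : M) = c := congrArg Subtype.val (g₂.injective hx)
      exact hcX (this ▸ x.2)⟩
  refine Or.inr (Or.inr ⟨i, ?_, ?_⟩)
  · rw [← hφ₂ c hcXC, hq a ha', col_embedding]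
    exact hi
  · have hX' : φ '' Set.range (g₁.comp (incl hXa)) = X := by
      ext x
      constructor
      · rintro ⟨_, ⟨y, rfl⟩, rfl⟩
        have : φ (g₁ ⟨y.1, hXa y.2⟩) = y.1 := hφ₁ y.1 y.2
        exact (show φ ((g₁.comp (incl hXa)) y) = y.1 from this) ▸ y.2
      · intro hx
        exact ⟨_, ⟨⟨x, hx⟩, rfl⟩, hφ₁ x hx⟩
    have := (chosen_image (S := S) (R := R) φ (B := Set.range (g₁.comp (incl hXa))) (i := i)).2 hi'
    rwa [hX', hφ₂ c hcXC, ← hq a ha'] at this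

theorem rich_of_limit [Countable M] (hprio : IsPrioritisedClass.{u, w} S R)
    (hM : FirstOrder.Language.IsFraisseLimit (Forb.{u, w} S) M) : Rich S R M :=
  ⟨complete_of_limit hM, omits_of_limit hM, homogeneous_of_limit hM, extension_of_limit hM,
    existence_of_limit hprio hM⟩

end Limit

/-! ### Calculus of the independence relation -/

section Independence

variable {ι : Type u} {S : Set (Sym ι 3)} {m : ℕ} {R : Fin m → ι}
variable {M : Type w} [(colourLanguage ι).Structure M] {B B' C : Set M} {a b c d a' c' : M}

@[simp] lemma aut_mul_apply (f g : M ≃[colourLanguage ι] M) (x : M) : (f * g) x = f (g x) := rfl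

@[simp] lemma aut_inv_apply_self (f : M ≃[colourLanguage ι] M) (x : M) : f⁻¹ (f x) = x :=
  f.symm_apply_apply x

@[simp] lemma aut_apply_inv_self (f : M ≃[colourLanguage ι] M) (x : M) : f (f⁻¹ x) = x :=
  f.apply_symm_apply x

lemma aut_inv_apply_eq {f : M ≃[colourLanguage ι] M} {x y : M} : f⁻¹ x = y ↔ x = f y :=
  ⟨fun h => by rw [← h, aut_apply_inv_self], fun h => by rw [h, aut_inv_apply_self]⟩

lemma aut_inv_apply_eq_self {f : M ≃[colourLanguage ι] M} {x : M} (h : f x = x) : f⁻¹ x = x :=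
  aut_inv_apply_eq.2 h.symm

lemma indep_singleton (hM : IsComplete ι M) : Indep S R {a} B {c} ↔ Ind S R B a c := by
  constructor
  · rintro ⟨-, h⟩
    by_cases ha : a ∈ B
    · exact Or.inl ha
    by_cases hc : c ∈ B
    · exact Or.inr (Or.inl hc)
    exact Or.inr (Or.inr (h a ⟨Or.inl rfl, ha⟩ c ⟨Or.inr rfl, hc⟩))
  · intro h
    have key : ∀ x ∈ ({a} ∪ B) \ B, ∀ y ∈ (B ∪ {c}) \ B,
        ∃ i, Col (R i) x y ∧ Chosen S R B x y i := by
      rintro x ⟨rfl | hx, hxB⟩ y ⟨hy | rfl, hyB⟩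
      · exact absurd hy hyB
      · exact (h.resolve_left hxB).resolve_left hyB
      · exact absurd hx hxB
      · exact absurd hx hxB
    refine ⟨?_, key⟩
    ext x
    refine ⟨fun hx => ?_, fun hx => ⟨Or.inr hx, Or.inl hx⟩⟩
    by_contra hxB
    obtain ⟨i, hi, -⟩ := key x ⟨hx.1, hxB⟩ x ⟨hx.2, hxB⟩
    exact hM.irrefl _ _ hi

lemma Ind.symm (h : Ind S R B a c) (hM : IsComplete ι M) : Ind S R B c a := by
  rcases h with h | h | ⟨i, hi, hi'⟩
  · exact Or.inr (Or.inl h)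
  · exact Or.inl h
  · exact Or.inr (Or.inr ⟨i, hM.symm _ _ _ hi, (chosen_comm hM).1 hi'⟩)

lemma Ind.mem_of_self (h : Ind S R B a a) (hM : IsComplete ι M) : a ∈ B := by
  rcases h with h | h | ⟨i, hi, -⟩
  · exact h
  · exact h
  · exact absurd hi (hM.irrefl _ _)

lemma Ind.map (h : Ind S R B a c) (s : M ≃[colourLanguage ι] M) :
    Ind S R (s '' B) (s a) (s c) := by
  rcases h with h | h | ⟨i, hi, hi'⟩
  · exact Or.inl ⟨a, h, rfl⟩
  · exact Or.inr (Or.inl ⟨c, h, rfl⟩)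
  · exact Or.inr (Or.inr ⟨i, (col_equiv s).2 hi, (chosen_image s.toEmbedding).2 hi'⟩)

/-- A colour rejected over `B` stays rejected over a larger base, while the actual colour is
admissible over every base because the structure omits `S`. -/
lemma Ind.mono (h : Ind S R B a c) (hM : OmitsTriangles S M) (hB : B ⊆ B') :
    Ind S R B' a c := by
  rcases h with h | h | ⟨i, hi, hi'⟩
  · exact Or.inl (hB h)
  · exact Or.inr (Or.inl (hB h))
  · refine Or.inr (Or.inr ⟨i, hi, hM.admissible hi, fun j hj h => hi'.2 j hj ?_⟩)
    exact fun b hb => h b (hB hb)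

/-- The point `b` cannot be what rejects a colour `R j` preferred to the actual `R i`: the triangle
would have the sides `R l` and `R j`, and `R j` is not the last solution because `j < i`. -/
lemma Ind.of_insert (hS : GoodColours S R) (h : Ind S R (insert b B) a c) (hM : IsComplete ι M)
    (hbc : b ≠ c) {l : Fin m} (hab : Col (R l) a b) : Ind S R B a c := by
  have hne : a ≠ b := by rintro rfl; exact hM.irrefl _ _ hab
  rcases h with h | h | ⟨i, hi, hi'⟩
  · exact Or.inl (h.resolve_left hne)
  · exact Or.inr (Or.inl (h.resolve_left hbc.symm))
  · refine Or.inr (Or.inr ⟨i, hi, fun b hb => hi'.1 b (Or.inr hb), fun j hj h => hi'.2 j hj ?_⟩)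
    rintro b' (rfl | hb') x y hx hy
    · have : x = R l := (hM.existsUnique a b' hne).unique hx hab
      rw [this, ← tri_rotate]
      exact hS.notLast j l i y hj
    · exact h b' hb' x y hx hy

/-- A point of `C` outside the base and different from `a` is joined to `a` by a solution, so
`Ind.of_insert` removes the points of `C` one by one. -/
lemma Ind.trans (hS : GoodColours S R) (hM : IsComplete ι M) (hC : C.Finite)
    (h : ∀ c ∈ C, Ind S R B a c) (hd : Ind S R (B ∪ C) a d) : Ind S R B a d := by
  induction C, hC using Set.Finite.induction_on with
  | empty => simpa using hd
  | @insert b C _ _ ih =>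
    rw [Set.union_insert] at hd
    rcases h b (Or.inl rfl) with hb | hb | ⟨i, hi, hi'⟩
    · exact Or.inl hb
    · rw [Set.insert_eq_of_mem (show b ∈ B ∪ C from Or.inl hb)] at hd
      exact ih (fun c hc => h c (Or.inr hc)) hd
    -- `Ind.of_insert` needs `b ≠ d`; in the excluded case the claim is one of the hypotheses.
    · by_cases hbd : b = d
      · exact hbd ▸ h b (Or.inl rfl)
      · exact ih (fun c hc => h c (Or.inr hc)) (hd.of_insert hS hM hbd hi)

/-- Stationarity: independent pairs of the same type over the base have the same colour. -/
lemma Ind.edge_eq (hM : IsComplete ι M) (σ : M → M) (h : Ind S R B a c)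
    (h' : Ind S R (σ '' B) a' c') (ha : ∀ b ∈ B, edge ι a b = edge ι a' (σ b))
    (hc : ∀ b ∈ B, edge ι c b = edge ι c' (σ b)) : edge ι a c = edge ι a' c' := by
  have eq_of : ∀ {x x' : M}, (∀ b ∈ B, edge ι x b = edge ι x' (σ b)) →
      ∀ b ∈ B, (x = b ↔ x' = σ b) := fun hx b hb => by
    rw [← edge_eq_none hM (ι := ι), ← edge_eq_none hM (ι := ι), hx b hb]
  by_cases haB : a ∈ B
  · have : a' = σ a := (eq_of ha a haB).1 rfl
    rw [edge_comm hM, hc a haB, this, edge_comm hM]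
  by_cases hcB : c ∈ B
  · have : c' = σ c := (eq_of hc c hcB).1 rfl
    rw [ha c hcB, this]
  have haB' : a' ∉ σ '' B := by
    rintro ⟨b, hb, hab⟩
    exact haB ((eq_of ha b hb).2 hab.symm ▸ hb)
  have hcB' : c' ∉ σ '' B := by
    rintro ⟨b, hb, hab⟩
    exact hcB ((eq_of hc b hb).2 hab.symm ▸ hb)
  obtain ⟨i, hi, hi'⟩ := (h.resolve_left haB).resolve_left hcB
  obtain ⟨j, hj, hj'⟩ := (h'.resolve_left haB').resolve_left hcB'
  have hadm : ∀ z, Admissible S (σ '' B) a' c' z ↔ Admissible S B a c z := by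
    intro z
    simp only [Admissible, Set.forall_mem_image]
    refine forall₂_congr fun b hb => forall₂_congr fun x y => ?_
    rw [← edge_eq_some hM, ← edge_eq_some hM, ← edge_eq_some hM, ← edge_eq_some hM, ha b hb,
      edge_comm hM b c, hc b hb, edge_comm hM (σ b) c']
  have hij : i = j := by
    refine Chosen.unique hi' ?_
    simpa only [Chosen, hadm] using hj'
  rw [(edge_eq_some hM).2 hi, (edge_eq_some hM).2 hj, hij]

theorem mainCondition (hS : GoodColours S R) (hM : IsComplete ι M) :
    MainCondition M S R := by
  refine ⟨fun i j z hi _ => hS.first i j z hi, fun a b c B _ hbc ⟨i, hi⟩ h => ?_⟩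
  rw [indep_singleton hM] at h ⊢
  exact h.of_insert hS hM hbc hi

lemma Ind.fix (h : Ind S R B a c) {s : M ≃[colourLanguage ι] M} (hs : ∀ x ∈ B, s x = x) :
    Ind S R B (s a) (s c) := by
  have := h.map s
  rwa [show s '' B = B from (Set.image_congr hs).trans (Set.image_id' B)] at this

end Independence

/-! ### Limits of coherent sequences of automorphisms -/

section BackAndForth

lemma exists_seq_of_step {σ : Type*} (I : σ → Prop) (P : ℕ → σ → σ → Prop) (s₀ : σ) (h₀ : I s₀)
    (step : ∀ n s, I s → ∃ s', I s' ∧ P n s s') :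
    ∃ s : ℕ → σ, s 0 = s₀ ∧ ∀ n, I (s n) ∧ P n (s n) (s (n + 1)) := by
  choose! f hf hP using step
  let s : ℕ → σ := fun n => Nat.rec s₀ f n
  have hs : ∀ n, I (s n) := fun n => by
    induction n with
    | zero => exact h₀
    | succ n ih => exact hf n _ ih
  exact ⟨s, rfl, fun n => ⟨hs n, hP n _ (hs n)⟩⟩

variable {ι : Type u} {M : Type w} [(colourLanguage ι).Structure M]

/-- The limit of a coherent sequence of automorphisms. -/
lemma exists_limit (h : ℕ → M ≃[colourLanguage ι] M) (D : ℕ → Set M)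
    (hD : ∀ n, D n ⊆ D (n + 1)) (agree : ∀ n, ∀ x ∈ D n, h (n + 1) x = h n x)
    (cover : ∀ x, ∃ n, x ∈ D n) (cover' : ∀ y, ∃ n, ∃ x ∈ D n, h n x = y) :
    ∃ H : M ≃[colourLanguage ι] M, ∀ n, ∀ x ∈ D n, H x = h n x := by
  have hmono : Monotone D := monotone_nat_of_le_succ hD
  have hagree : ∀ n k, n ≤ k → ∀ x ∈ D n, h k x = h n x := by
    intro n k hnk x hx
    induction k, hnk using Nat.le_induction with
    | base => rfl
    | succ k hk ih => rw [agree k x (hmono hk hx), ih]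
  choose N hN using cover
  have hF : ∀ n, ∀ x ∈ D n, h (N x) x = h n x := fun n x hx => by
    rcases le_total n (N x) with hle | hle
    · exact hagree _ _ hle x hx
    · exact (hagree _ _ hle x (hN x)).symm
  have hpair : ∀ x y, ∃ n, x ∈ D n ∧ y ∈ D n := fun x y =>
    ⟨max (N x) (N y), hmono (le_max_left _ _) (hN x), hmono (le_max_right _ _) (hN y)⟩
  let F : M → M := fun x => h (N x) x
  have hinj : Function.Injective F := fun x y hxy => by
    obtain ⟨n, hx, hy⟩ := hpair x y
    have : h n x = h n y := by rw [← hF n x hx, ← hF n y hy]; exact hxy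
    exact (h n).injective this
  have hsurj : Function.Surjective F := fun y => by
    obtain ⟨n, x, hx, rfl⟩ := cover' y
    exact ⟨x, hF n x hx⟩
  have hcol : ∀ (z : ι) (x y : M), Col z (F x) (F y) ↔ Col z x y := fun z x y => by
    obtain ⟨n, hx, hy⟩ := hpair x y
    have h1 : F x = h n x := hF n x hx
    have h2 : F y = h n y := hF n y hy
    rw [h1, h2, col_equiv]
  let e := embeddingOf F hinj hcol
  refine ⟨⟨Equiv.ofBijective F ⟨hinj, hsurj⟩, e.map_fun', e.map_rel'⟩, fun n x hx => hF n x hx⟩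

end BackAndForth

/-! ### Commutators that move points to independent points -/

section Commutators

variable {ι : Type u} {S : Set (Sym ι 3)} {m : ℕ} {R : Fin m → ι}
variable {M : Type w} [(colourLanguage ι).Structure M]

/-- A rich structure for a good choice of colours. -/
structure Tame (S : Set (Sym ι 3)) (R : Fin m → ι) (M : Type w)
    [(colourLanguage ι).Structure M] : Prop extends Rich S R M, GoodColours S R

lemma Tame.ind_trans (hT : Tame S R M) {B C : Set M} {a d : M} (hC : C.Finite)
    (h : ∀ c ∈ C, Ind S R B a c) (hd : Ind S R (B ∪ C) a d) : Ind S R B a d :=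
  Ind.trans hT.toGoodColours hT.complete hC h hd

/-- A point independent from itself lies in the base, so a realisation of a non-algebraic type that
is independent from `C` avoids `C`. -/
lemma Tame.exists_generic (hT : Tame S R M) {X C : Set M} (hX : X.Finite) (hC : C.Finite) {a : M}
    (ha : a ∉ X) : ∃ s : M ≃[colourLanguage ι] M, (∀ x ∈ X, s x = x) ∧
      (∀ c ∈ C, Ind S R X (s a) c) ∧ s a ∉ C := by
  obtain ⟨s, hs, hs'⟩ := hT.existence X C hX hC a
  refine ⟨s, hs, hs', fun h => ha ?_⟩
  have h1 := (hs' _ h).mem_of_self hT.complete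
  have h2 := s.injective (hs _ h1)
  exact h2 ▸ h1

/-- The commutator `[h, g]` moves some realisation `a` of the type of `a₀` over `X` to a point that
is independent from `a` over a set that consists of `g a` and points independent from `a`. -/
def CommGeneric (S : Set (Sym ι 3)) (R : Fin m → ι) (Φ : M → M → Prop)
    (h g : M ≃[colourLanguage ι] M) (X : Set M) (a₀ : M) : Prop :=
  ∃ s : M ≃[colourLanguage ι] M, (∀ x ∈ X, s x = x) ∧ ∃ X' : Set M, X'.Finite ∧ X ⊆ X' ∧
    (∀ x ∈ X', Ind S R X (s a₀) x) ∧ s a₀ ∉ X' ∧ comm h g (s a₀) ∉ X' ∧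
    Φ (s a₀) (g (s a₀)) ∧ Φ (comm h g (s a₀)) (g (s a₀)) ∧
    Ind S R (insert (g (s a₀)) X') (comm h g (s a₀)) (s a₀)

variable {Φ : M → M → Prop} {g : M ≃[colourLanguage ι] M}

/-- If `h` sends `a'` to `e` and `g a` to `g e`, then `[h, g] a = a'`. Keeping `h` on `D ∪ X`, there
is freedom first to choose the value `g e` at `g a`, with `Φ e (g e)`, and then to choose the
preimage `a'` of `e` independent from `a` over `g a` and `D ∪ X`. Applying `h` turns `Φ a' (g a)`
into `Φ e (g e)`. -/
lemma Tame.commGeneric_step (hT : Tame S R M)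
    (hΦ : ∀ (s : M ≃[colourLanguage ι] M) (a b : M), Φ (s a) (s b) ↔ Φ a b)
    (hg : ∀ X : Set M, X.Finite → ∀ a ∉ X, ∃ s : M ≃[colourLanguage ι] M,
      (∀ x ∈ X, s x = x) ∧ Φ (s a) (g (s a)))
    (h : M ≃[colourLanguage ι] M) {D X : Set M} (hD : D.Finite) (hX : X.Finite) {a₀ : M}
    (ha₀ : a₀ ∉ X) :
    ∃ (h' : M ≃[colourLanguage ι] M) (D' : Set M), D'.Finite ∧ D ⊆ D' ∧ (∀ x ∈ D, h' x = h x) ∧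
      ∀ H : M ≃[colourLanguage ι] M, (∀ x ∈ D', H x = h' x) → CommGeneric S R Φ H g X a₀ := by
  set D₁ := D ∪ X with hD₁
  have hD₁f : D₁.Finite := hD.union hX
  have hEf : (D₁ ∪ ⇑(g⁻¹) '' D₁).Finite := hD₁f.union (hD₁f.image _)
  -- Avoiding `g⁻¹ D₁` keeps `g a` outside `D₁`, where `h` is already fixed.
  obtain ⟨s₁, hs₁, hi₁, hn₁⟩ := hT.exists_generic hX hEf ha₀
  obtain ⟨s₂, hs₂, hΦa⟩ := hg _ hEf _ hn₁
  have haE : s₂ (s₁ a₀) ∉ D₁ ∪ ⇑(g⁻¹) '' D₁ := fun h => hn₁ (by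
    have := s₂.injective (hs₂ _ h)
    rwa [this] at h)
  have hXD : X ⊆ D₁ := Set.subset_union_right
  obtain ⟨a, ha⟩ : ∃ a, a = s₂ (s₁ a₀) := ⟨_, rfl⟩
  rw [← ha] at hΦa haE
  have haX : ∀ x ∈ D₁, Ind S R X a x := fun x hx => by
    have := (hi₁ x (Or.inl hx)).fix (s := s₂) (fun y hy => hs₂ y (Or.inl (hXD hy)))
    rwa [hs₂ x (Or.inl hx), ← ha] at this
  have hc : g a ∉ D₁ := fun h => haE (Or.inr ⟨g a, h, by simp⟩)
  set F := h '' D₁ with hF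
  have hFf : F.Finite := hD₁f.image _
  have hF'f : (F ∪ g '' F).Finite := hFf.union (hFf.image _)
  obtain ⟨s₃, hs₃, -, hn₃⟩ := hT.exists_generic (a := h (g a)) hFf hF'f (by
    rintro ⟨x, hx, hxa⟩
    exact hc (h.injective hxa ▸ hx))
  obtain ⟨s₄, hs₄, hΦd⟩ := hg (⇑(g⁻¹) '' (F ∪ g '' F)) (hF'f.image _) (g⁻¹ (s₃ (h (g a)))) (by
    rintro ⟨x, hx, hxa⟩
    exact hn₃ ((g⁻¹).injective hxa ▸ hx))
  -- The factor `s₃` moves the value at `g a` off `F ∪ g F`; the conjugate of `s₄` by `g` then gives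
  -- it the form `g e` with `Φ e (g e)`. Both factors fix `F` pointwise.
  let h₁ := g * s₄ * g⁻¹ * s₃ * h
  have hfix₄ : ∀ x ∈ F ∪ g '' F, g (s₄ (g⁻¹ x)) = x := fun x hx => by
    rw [hs₄ _ ⟨x, hx, rfl⟩, aut_apply_inv_self]
  have hh₁ : ∀ x ∈ D₁, h₁ x = h x := fun x hx => by
    have hx' : h x ∈ F := ⟨x, hx, rfl⟩
    simp only [h₁, aut_mul_apply]
    rw [hs₃ _ hx', hfix₄ _ (Or.inl hx')]
  obtain ⟨e, he⟩ : ∃ e, e = s₄ (g⁻¹ (s₃ (h (g a)))) := ⟨_, rfl⟩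
  have hd : h₁ (g a) = g e := by rw [he]; rfl
  have hdF : g e ∉ F ∪ g '' F := fun hmem => hn₃ (by
    have h1 := hfix₄ _ hmem
    rw [he] at h1 hmem
    have h2 := (g⁻¹).injective (s₄.injective (g.injective h1))
    rwa [h2] at hmem)
  rw [← he] at hΦd
  obtain ⟨t, ht, hti⟩ := hT.existence (insert (g a) D₁) {a} (hD₁f.insert _)
    (Set.finite_singleton a) (h₁⁻¹ e)
  have hti := hti a rfl
  obtain ⟨a', ha'⟩ : ∃ a', a' = t (h₁⁻¹ e) := ⟨_, rfl⟩
  rw [← ha'] at hti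
  let h₂ := h₁ * t⁻¹
  have hh₂ : ∀ x ∈ insert (g a) D₁, h₂ x = h₁ x := fun x hx => by
    simp only [h₂, aut_mul_apply]
    rw [aut_inv_apply_eq_self (ht x hx)]
  have hh₂a : h₂ a' = e := by simp [h₂, ha']
  have hh₂c : h₂ (g a) = g e := by rw [hh₂ _ (Or.inl rfl), hd]
  have hh₂D : ∀ x ∈ D₁, h₂ x = h x := fun x hx => by rw [hh₂ x (Or.inr hx), hh₁ x hx]
  have ha'D : a' ∉ D₁ := fun hmem => by
    refine hdF (Or.inr ⟨e, ⟨a', hmem, ?_⟩, rfl⟩)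
    rw [← hh₂D _ hmem, hh₂a]
  refine ⟨h₂, insert a' (insert (g a) D₁), (hD₁f.insert _).insert _,
    fun x hx => Or.inr (Or.inr (Or.inl hx)), fun x hx => hh₂D x (Or.inl hx), fun H hH => ?_⟩
  have hcomm : comm H g a = a' := by
    simp only [comm, aut_mul_apply]
    rw [aut_inv_apply_eq, hH a' (Or.inl rfl), hH (g a) (Or.inr (Or.inl rfl)), hh₂a, hh₂c,
      aut_inv_apply_self]
  refine ⟨s₂ * s₁, fun x hx => ?_, D₁, hD₁f, hXD, ?_⟩
  · rw [aut_mul_apply, hs₁ x hx, hs₂ x (Or.inl (hXD hx))]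
  · rw [aut_mul_apply, ← ha, hcomm]
    refine ⟨haX, fun h => haE (Or.inl h), ha'D, hΦa, ?_, hti⟩
    rw [← hΦ h₂, hh₂a, hh₂c]
    exact hΦd

theorem Tame.exists_commGeneric [Countable M] (hT : Tame S R M)
    (hΦ : ∀ (s : M ≃[colourLanguage ι] M) (a b : M), Φ (s a) (s b) ↔ Φ a b)
    (hg : ∀ X : Set M, X.Finite → ∀ a ∉ X, ∃ s : M ≃[colourLanguage ι] M,
      (∀ x ∈ X, s x = x) ∧ Φ (s a) (g (s a))) :
    ∃ h : M ≃[colourLanguage ι] M, ∀ X : Set M, X.Finite → ∀ a₀ ∉ X,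
      CommGeneric S R Φ h g X a₀ := by
  rcases isEmpty_or_nonempty M with hM | hM
  · exact ⟨1, fun X _ a => (hM.false a).elim⟩
  obtain ⟨task, htask⟩ := exists_surjective_nat (Finset M × M)
  obtain ⟨s, -, hs⟩ := exists_seq_of_step
    (σ := (M ≃[colourLanguage ι] M) × Set M) (fun s => s.2.Finite)
    (fun n s s' => s.2 ⊆ s'.2 ∧ (∀ x ∈ s.2, s'.1 x = s.1 x) ∧ (task n).2 ∈ s'.2 ∧
      (∃ x ∈ s'.2, s'.1 x = (task n).2) ∧ ((task n).2 ∉ (task n).1 →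
        ∀ H : M ≃[colourLanguage ι] M, (∀ x ∈ s'.2, H x = s'.1 x) →
          CommGeneric S R Φ H g (task n).1 (task n).2)) (1, ∅) Set.finite_empty (by
      rintro n ⟨h, D⟩ hD
      obtain ⟨h', D', hD', hDD', hh', hH⟩ : ∃ (h' : M ≃[colourLanguage ι] M) (D' : Set M),
          D'.Finite ∧ D ⊆ D' ∧ (∀ x ∈ D, h' x = h x) ∧ ((task n).2 ∉ (task n).1 →
            ∀ H : M ≃[colourLanguage ι] M, (∀ x ∈ D', H x = h' x) →
              CommGeneric S R Φ H g (task n).1 (task n).2) := by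
        by_cases hmem : (task n).2 ∈ (task n).1
        · exact ⟨h, D, hD, subset_rfl, fun _ _ => rfl, fun hn => absurd hmem hn⟩
        · obtain ⟨h', D', h1, h2, h3, h4⟩ := hT.commGeneric_step hΦ hg h hD
            (Finset.finite_toSet (task n).1) (a₀ := (task n).2) (by simpa using hmem)
          exact ⟨h', D', h1, h2, h3, fun _ => h4⟩
      refine ⟨(h', insert (task n).2 (insert (h'⁻¹ (task n).2) D')), (hD'.insert _).insert _,
        fun x hx => Or.inr (Or.inr (hDD' hx)), hh', Or.inl rfl,
        ⟨_, Or.inr (Or.inl rfl), aut_apply_inv_self _ _⟩,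
        fun hn H hagree => hH hn H fun x hx => hagree x (Or.inr (Or.inr hx))⟩)
  obtain ⟨H, hH⟩ := exists_limit (fun n => (s n).1) (fun n => (s n).2) (fun n => (hs n).2.1)
    (fun n => (hs n).2.2.1)
    (fun x => by
      obtain ⟨n, hn⟩ := htask (∅, x)
      refine ⟨n + 1, ?_⟩
      have := (hs n).2.2.2.1
      rwa [hn] at this)
    (fun y => by
      obtain ⟨n, hn⟩ := htask (∅, y)
      refine ⟨n + 1, ?_⟩
      have := (hs n).2.2.2.2.1
      rwa [hn] at this)
  refine ⟨H, fun X hX a₀ ha₀ => ?_⟩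
  obtain ⟨n, hn⟩ := htask (hX.toFinset, a₀)
  have := (hs n).2.2.2.2.2
  rw [hn] at this
  simpa using this (by simpa using ha₀) H (hH (n + 1))

/-- If `g` moves a realisation of every non-algebraic type, then some commutator `[h, g]` maps a
realisation of every such type to a point that is joined to it by a solution. -/
theorem Tame.exists_comm_solution [Countable M] (hT : Tame S R M)
    (hg : ∀ X : Set M, X.Finite → ∀ a ∉ X, ∃ s : M ≃[colourLanguage ι] M,
      (∀ x ∈ X, s x = x) ∧ s a ≠ g (s a)) :
    ∃ h : M ≃[colourLanguage ι] M, ∀ X : Set M, X.Finite → ∀ a ∉ X,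
      ∃ s : M ≃[colourLanguage ι] M, (∀ x ∈ X, s x = x) ∧
        ∃ i, Col (R i) (s a) (comm h g (s a)) := by
  obtain ⟨h, hh⟩ := hT.exists_commGeneric (Φ := fun a b => a ≠ b)
    (fun s a b => s.injective.ne_iff) hg
  refine ⟨h, fun X hX a ha => ?_⟩
  obtain ⟨s, hs, X', -, -, -, h1, h2, h3, h4, h5⟩ := hh X hX a ha
  refine ⟨s, hs, ?_⟩
  rcases h5 with h5 | h5 | ⟨i, hi, -⟩
  · exact absurd h5 (by simp [h4, h2])
  · exact absurd h5 (by simp [h3, h1])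
  · exact ⟨i, hT.complete.symm _ _ _ hi⟩

theorem Tame.exists_comm_movesAlmostMaximally [Countable M] (hT : Tame S R M)
    (hg : ∀ X : Set M, X.Finite → ∀ a ∉ X, ∃ s : M ≃[colourLanguage ι] M,
      (∀ x ∈ X, s x = x) ∧ ∃ i, Col (R i) (s a) (g (s a))) :
    ∃ h : M ≃[colourLanguage ι] M, MovesAlmostMaximally S R (comm h g) := by
  obtain ⟨h, hh⟩ := hT.exists_commGeneric (Φ := fun a b => ∃ i, Col (R i) a b)
    (fun s a b => by simp only [col_equiv]) hg
  refine ⟨h, fun X hX a => ?_⟩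
  by_cases ha : a ∈ X
  · exact ⟨a, ⟨1, fun _ _ => rfl, rfl⟩, (indep_singleton hT.complete).2 (Or.inl ha)⟩
  obtain ⟨s, hs, X', hX', hXX', h1, -, -, ⟨i, hi⟩, ⟨j, hj⟩, h5⟩ := hh X hX a ha
  refine ⟨s a, ⟨s, hs, rfl⟩, (indep_singleton hT.complete).2 ?_⟩
  -- Here `Φ` means being joined by a solution: for `a` and `g a` it permits dropping `g a` from the
  -- base, and for `[h, g] a` and `g a` it shows that these points differ.
  have h6 := (h5.symm hT.complete).of_insert hT.toGoodColours hT.complete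
    (fun h => hT.complete.irrefl _ _ (h ▸ hj)) hi
  exact hT.ind_trans hX' h1 (by rwa [Set.union_eq_self_of_subset_left hXX'])

end Commutators

/-! ### Non-trivial automorphisms move realisations of every type -/

section Nontrivial

variable {ι : Type u} {S : Set (Sym ι 3)} {m : ℕ} {R : Fin m → ι}
variable {M : Type w} [(colourLanguage ι).Structure M]

lemma Tame.exists_col (hT : Tame S R M) (t : ι) (b : M) : ∃ a, Col t a b := by
  obtain ⟨a, -, ha⟩ := hT.extension {b} (Set.finite_singleton b) (fun _ => t) (by
    rintro y rfl y' rfl z hz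
    exact absurd hz (hT.complete.irrefl _ _))
  exact ⟨a, ha b rfl⟩

/-- There is a first solution, and a second colour such that no triangle of `S` has two sides of
these two colours. -/
lemma Tame.exists_two_colours (hT : Tame S R M) (hR : Function.Injective R)
    (hproper : Set.range R ⊂ Set.univ) :
    ∃ i₀ : Fin m, (i₀ : ℕ) = 0 ∧ ∃ T, T ≠ R i₀ ∧ ∀ z, tri (R i₀) T z ∉ S := by
  obtain ⟨t, -, ht⟩ := Set.exists_of_ssubset hproper
  obtain ⟨b, -, -⟩ := hT.extension ∅ Set.finite_empty (fun _ => t) (by simp)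
  obtain ⟨a, ha⟩ := hT.exists_col t b
  have hm : 0 < m := by
    obtain ⟨s, -, hs, -⟩ := hT.exists_generic Set.finite_empty (Set.finite_singleton b)
      (Set.notMem_empty b)
    rcases hs b rfl with h | h | ⟨i, -⟩
    · exact absurd h (Set.notMem_empty _)
    · exact absurd h (Set.notMem_empty _)
    · exact i.pos
  refine ⟨⟨0, hm⟩, rfl, ?_⟩
  by_cases h2 : 1 < m
  · refine ⟨R ⟨1, h2⟩, fun h => ?_, fun z => hT.first _ _ z rfl⟩
    simpa using hR h
  -- With a single solution any colour outside `L'` will do: amalgamating an edge `t` and an edge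
  -- `z` over their common vertex must produce the triangle with third side the solution.
  refine ⟨t, fun h => ht ⟨_, h.symm⟩, fun z hz => ?_⟩
  obtain ⟨c, hc⟩ := hT.exists_col z b
  obtain ⟨s, hs, hs'⟩ := hT.existence {b} {c} (Set.finite_singleton b) (Set.finite_singleton c) a
  have hsa : Col t (s a) b := by
    have := (col_equiv s).2 ha
    rwa [hs b rfl] at this
  rcases hs' c rfl with h | h | ⟨i, hi, -⟩
  · exact hT.complete.irrefl _ _ (h ▸ hsa)
  · exact hT.complete.irrefl _ _ (h ▸ hc)
  · obtain rfl : i = ⟨0, hm⟩ := Fin.ext (by have := i.2; simp only; omega)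
    refine hT.omits (s a) b c t z _ hsa (hT.complete.symm _ _ _ hc) hi ?_
    rwa [← tri_rotate]

/-- Realising the type of `a` over `Y` by a point with a prescribed colour to `b`. -/
lemma Tame.exists_col_over (hT : Tame S R M) {Y : Set M} (hY : Y.Finite) {a b : M} (ha : a ∉ Y)
    (hb : b ∉ Y) {v : ι}
    (hv : ∀ y ∈ Y, ∀ z x : ι, Col z b y → Col x a y → tri v z x ∉ S) :
    ∃ s : M ≃[colourLanguage ι] M, (∀ y ∈ Y, s y = y) ∧ Col v (s a) b := by
  classical
  have hc := hT.complete
  have : Nonempty ι := ⟨v⟩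
  choose! t ht _ using fun y (hy : y ∈ Y) => hc.existsUnique a y (fun h => ha (h ▸ hy))
  have hne : ∀ y ∈ Y, y ≠ b := fun y hy h => hb (h ▸ hy)
  obtain ⟨a', ha', hcol⟩ := hT.extension (insert b Y) (hY.insert b) (Function.update t b v) (by
    rintro y (rfl | hy) y' (rfl | hy') z hz
    · exact absurd hz (hc.irrefl _ _)
    · rw [Function.update_self, Function.update_of_ne (hne y' hy')]
      exact hv y' hy' z _ hz (ht y' hy')
    · rw [Function.update_self, Function.update_of_ne (hne y hy), ← tri_rotate,
        tri_swap_right]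
      exact hv y hy z _ (hc.symm _ _ _ hz) (ht y hy)
    · rw [Function.update_of_ne (hne y hy), Function.update_of_ne (hne y' hy')]
      exact hT.omits y a y' _ _ _ (hc.symm _ _ _ (ht y hy)) (ht y' hy') hz ∘
        fun h => by rwa [tri_swap_right])
  have hcolY : ∀ y ∈ Y, Col (t y) a' y := fun y hy => by
    have := hcol y (Or.inr hy)
    rwa [Function.update_of_ne (hne y hy)] at this
  obtain ⟨s, hs⟩ := hT.homogeneous (insert (a, a') ((fun y => (y, y)) '' Y))
    ((hY.image _).insert _) (by
      have key : ∀ y ∈ Y, edge ι a y = edge ι a' y := fun y hy => by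
        rw [(edge_eq_some hc).2 (ht y hy), (edge_eq_some hc).2 (hcolY y hy)]
      rintro _ (rfl | ⟨y, hy, rfl⟩) _ (rfl | ⟨y', hy', rfl⟩)
      · simp only [(edge_eq_none hc).2]
      · exact key y' hy'
      · rw [edge_comm hc, edge_comm hc y]
        exact key y hy
      · rfl)
  refine ⟨s, fun y hy => hs _ (Or.inr ⟨y, hy, rfl⟩), ?_⟩
  have h1 : s a = a' := hs _ (Or.inl rfl)
  have h2 := hcol b (Or.inl rfl)
  rwa [Function.update_self, ← h1] at h2

/-- Any triangle at the new point has sides `r, r` or `r, T`, which are never forbidden. Such a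
point distinguishes `b` from all other points of `Y`, so an automorphism fixing it cannot move `b`
within `Y`. -/
lemma Tame.exists_col_special (hT : Tame S R M) {r T : ι} (hr : ∀ z, tri r r z ∉ S)
    (hrT : ∀ z, tri r T z ∉ S) {Y : Set M} (hY : Y.Finite) {b : M} (hb : b ∈ Y) :
    ∃ a ∉ Y, Col T a b ∧ ∀ y ∈ Y, y ≠ b → Col r a y := by
  classical
  obtain ⟨a, ha, hcol⟩ := hT.extension Y hY (Function.update (fun _ => r) b T) (by
    intro y hy y' hy' z hz
    rw [tri_swap_right]
    by_cases hyb : y = b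
    · have hyb' : y' ≠ b := by
        rintro rfl
        exact hT.complete.irrefl _ _ (hyb ▸ hz)
      rw [Function.update_of_ne hyb', hyb, Function.update_self, tri_swap_left]
      exact hrT z
    · rw [Function.update_of_ne hyb]
      by_cases hyb' : y' = b
      · rw [hyb', Function.update_self]
        exact hrT z
      · rw [Function.update_of_ne hyb']
        exact hr z)
  refine ⟨a, ha, ?_, fun y hy hyb => ?_⟩
  · simpa using hcol b hb
  · simpa [Function.update_of_ne hyb] using hcol y hy

/-- A non-trivial automorphism moves a realisation of every non-algebraic type. -/
theorem Tame.exists_moved (hT : Tame S R M) (hR : Function.Injective R)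
    (hproper : Set.range R ⊂ Set.univ) {g : M ≃[colourLanguage ι] M} (hg : g ≠ 1) {X : Set M}
    (hX : X.Finite) {a₀ : M} (ha₀ : a₀ ∉ X) :
    ∃ s : M ≃[colourLanguage ι] M, (∀ x ∈ X, s x = x) ∧ s a₀ ≠ g (s a₀) := by
  obtain ⟨i₀, hi₀, T, hT₀, hTS⟩ := hT.exists_two_colours hR hproper
  have hRS : ∀ j z, tri (R i₀) (R j) z ∉ S := fun j z => hT.first i₀ j z hi₀
  by_contra! hfix
  have hc := hT.complete
  have huniq : ∀ {a b : M} {x y : ι}, Col x a b → Col y a b → x = y := by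
    intro a b x y hx hy
    have hne : a ≠ b := by rintro rfl; exact hc.irrefl _ _ hx
    exact (hc.existsUnique a b hne).unique hx hy
  have hpres : ∀ {a b : M} {x y : ι}, a = g a → Col x a b → Col y a (g b) → x = y := by
    intro a b x y ha hx hy
    have h1 : Col x (g a) (g b) := (col_equiv g).2 hx
    rw [← ha] at h1
    exact huniq h1 hy
  -- If `g` moved `b`, the type of `a₀` would have a realisation with different colours to `b` and
  -- `g b`. Such a point cannot be fixed by `g`.
  have hgen : ∀ b : M, b ∉ X → (∀ x ∈ X, Col (R i₀) b x) → g b = b := by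
    intro b hb hbX
    by_contra hgb
    obtain ⟨s, hs, hind, hn⟩ := hT.exists_generic hX (hX.insert (g b)) ha₀
    obtain ⟨x, hx, -⟩ := hc.existsUnique (s a₀) (g b) (fun h => hn (Or.inl h))
    have hgood : g b ∈ X ∨ ∃ j, x = R j := by
      rcases hind (g b) (Or.inl rfl) with h | h | ⟨j, hj, -⟩
      · exact absurd (Or.inr h) hn
      · exact Or.inl h
      · exact Or.inr ⟨j, huniq hx hj⟩
    -- The colour to `b` is the first solution, or `T` when the colour `x` to `g b` already is the
    -- first solution.
    obtain ⟨v, hvx, hvR, hvt⟩ : ∃ v, v ≠ x ∧ (∀ z, tri (R i₀) v z ∉ S) ∧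
        (g b ∉ X → ∀ z, tri v z x ∉ S) := by
      by_cases h : x = R i₀
      · refine ⟨T, h ▸ hT₀, hTS, fun _ z => ?_⟩
        rw [tri_swap_right, tri_swap_left, h]
        exact hTS z
      · refine ⟨R i₀, Ne.symm h, hRS i₀, fun hX z => ?_⟩
        obtain ⟨j, rfl⟩ := hgood.resolve_left hX
        rw [tri_swap_right]
        exact hRS j z
    obtain ⟨q, hq, hqv⟩ := hT.exists_col_over (hX.insert (g b)) (a := s a₀) (b := b) (v := v) hn
      (by rintro (h | h); exacts [hgb h.symm, hb h]) (by
        intro y hy z x' hz hx'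
        by_cases hyX : y ∈ X
        · rw [huniq hz (hbX y hyX), tri_swap_left]
          exact hvR x'
        · obtain rfl : y = g b := hy.resolve_right hyX
          rw [huniq hx' hx]
          exact hvt hyX z)
    have hfixed := hfix (q * s) (fun y hy => by rw [aut_mul_apply, hs y hy, hq y (Or.inr hy)])
    refine hvx (hpres hfixed hqv ?_)
    have := (col_equiv q).2 hx
    rwa [hq _ (Or.inl rfl)] at this
  -- A special point joined to `X` by the first solution is fixed by `hgen`, yet has different
  -- colours to `b` and `g b`.
  have hout : ∀ b ∉ X, g b = b := by
    intro b hb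
    by_contra hgb
    obtain ⟨a, ha, haT, haR⟩ := hT.exists_col_special (hRS i₀) hTS
      ((hX.insert (g b)).insert b) (b := b) (Or.inl rfl)
    have := hgen a (fun h => ha (Or.inr (Or.inr h))) (fun x hx =>
      haR x (Or.inr (Or.inr hx)) (fun h => hb (h ▸ hx)))
    exact hT₀ (hpres this.symm haT (haR _ (Or.inr (Or.inl rfl)) hgb))
  refine hg (FirstOrder.Language.Equiv.ext fun b => ?_)
  change g b = b
  by_contra hgb
  obtain ⟨a, ha, haT, haR⟩ := hT.exists_col_special (hRS i₀) hTS
    ((hX.insert (g b)).insert b) (b := b) (Or.inl rfl)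
  have := hout a (fun h => ha (Or.inr (Or.inr h)))
  exact hT₀ (hpres this.symm haT (haR _ (Or.inr (Or.inl rfl)) hgb))

/-- Some double commutator of a non-trivial automorphism moves almost maximally. -/
theorem Tame.exists_comm_comm [Countable M] (hT : Tame S R M) (hR : Function.Injective R)
    (hproper : Set.range R ⊂ Set.univ) {g : M ≃[colourLanguage ι] M} (hg : g ≠ 1) :
    ∃ k h : M ≃[colourLanguage ι] M, MovesAlmostMaximally S R (comm k (comm h g)) := by
  obtain ⟨h, hh⟩ := hT.exists_comm_solution fun X hX a ha => hT.exists_moved hR hproper hg hX ha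
  obtain ⟨k, hk⟩ := hT.exists_comm_movesAlmostMaximally hh
  exact ⟨k, h, hk⟩

end Nontrivial

/-! ### Almost maximal movement for tuples and for conjugates -/

section AlmostMaximal

variable {ι : Type u} {S : Set (Sym ι 3)} {m : ℕ} {R : Fin m → ι}
variable {M : Type w} [(colourLanguage ι).Structure M] {g : M ≃[colourLanguage ι] M}

lemma Tame.symm (hT : Tame S R M) {B : Set M} {a c : M} (h : Ind S R B a c) : Ind S R B c a :=
  Ind.symm h hT.complete

/-- Every finite tuple has a realisation of its type over `X` that is independent from `C`. -/
lemma Tame.exists_generic_set (hT : Tame S R M) {A X C : Set M} (hA : A.Finite) (hX : X.Finite)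
    (hC : C.Finite) : ∃ s : M ≃[colourLanguage ι] M, (∀ x ∈ X, s x = x) ∧
      ∀ a ∈ A, ∀ c ∈ C, Ind S R X (s a) c := by
  induction A, hA using Set.Finite.induction_on with
  | empty => exact ⟨1, fun _ _ => rfl, by simp⟩
  | @insert y A _ hA ih =>
    obtain ⟨s, hs, hind⟩ := ih
    obtain ⟨t, ht, hti⟩ := hT.existence (X ∪ s '' A) C (hX.union (hA.image _)) hC (s y)
    have htA : ∀ a ∈ A, t (s a) = s a := fun a ha => ht _ (Or.inr ⟨a, ha, rfl⟩)
    refine ⟨t * s, fun x hx => ?_, ?_⟩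
    · rw [aut_mul_apply, hs x hx, ht x (Or.inl hx)]
    · rintro a (rfl | ha) c hc
      · refine hT.symm (hT.ind_trans (hA.image s) ?_ (hT.symm (hti c hc)))
        rintro _ ⟨a', ha', rfl⟩
        exact hT.symm (hind a' ha' c hc)
      · rw [aut_mul_apply, htA a ha]
        exact hind a ha c hc

/-- Almost maximal movement is applied over `X ∪ W` to a realisation already independent from `W`;
transitivity then removes `W`. -/
lemma Tame.exists_ind_apply (hT : Tame S R M) (hg : MovesAlmostMaximally S R g) {X W : Set M}
    (hX : X.Finite) (hW : W.Finite) (a : M) :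
    ∃ s : M ≃[colourLanguage ι] M, (∀ x ∈ X, s x = x) ∧ (∀ c ∈ W, Ind S R X (s a) c) ∧
      Ind S R X (s a) (g (s a)) := by
  obtain ⟨s, hs, hsi⟩ := hT.existence X W hX hW a
  obtain ⟨_, ⟨t, ht, rfl⟩, hti⟩ := hg (X ∪ W) (hX.union hW) (s a)
  rw [indep_singleton hT.complete] at hti
  have hW' : ∀ c ∈ W, Ind S R X (t (s a)) c := fun c hc => by
    have := (hsi c hc).fix (s := t) fun x hx => ht x (Or.inl hx)
    rwa [ht c (Or.inr hc)] at this
  refine ⟨t * s, fun x hx => ?_, hW', hT.ind_trans hW hW' hti⟩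
  rw [aut_mul_apply, hs x hx, ht x (Or.inl hx)]

/-- Moving almost maximally, for finite tuples. -/
lemma Tame.exists_ind_apply_set (hT : Tame S R M) (hg : MovesAlmostMaximally S R g) {A : Set M}
    (hA : A.Finite) {X W : Set M} (hX : X.Finite) (hW : W.Finite) :
    ∃ s : M ≃[colourLanguage ι] M, (∀ x ∈ X, s x = x) ∧ (∀ a ∈ A, ∀ c ∈ W, Ind S R X (s a) c) ∧
      ∀ a ∈ A, ∀ a' ∈ A, Ind S R X (s a) (g (s a')) := by
  induction A, hA using Set.Finite.induction_on generalizing W with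
  | empty => exact ⟨1, fun _ _ => rfl, by simp, by simp⟩
  | @insert y A _ hA ih =>
    obtain ⟨s, hs, hsW, hsg⟩ := ih (hW.union (hX.image g))
    have hsA : (s '' A).Finite := hA.image s
    have hXA : (X ∪ s '' A).Finite := hX.union hsA
    obtain ⟨t, ht, htW, htg⟩ := hT.exists_ind_apply hg hXA
      ((hW.union (hsA.image g)).union ((hsA.image ⇑(g⁻¹)))) (s y)
    have htA : ∀ a ∈ A, t (s a) = s a := fun a ha => ht _ (Or.inr ⟨a, ha, rfl⟩)
    have lift : ∀ z, (∀ a ∈ A, Ind S R X (s a) z) → Ind S R (X ∪ s '' A) (t (s y)) z →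
        Ind S R X (t (s y)) z := by
      intro z hz h
      refine hT.symm (hT.ind_trans hsA ?_ (hT.symm h))
      rintro _ ⟨a, ha, rfl⟩
      exact hT.symm (hz a ha)
    -- The new point was made independent from `g⁻¹ (s a)` over `X ∪ s A`; applying `g` moves the
    -- base to `g X ∪ g s A`, whose points are independent from `s a` over `X`.
    have hAy : ∀ a ∈ A, Ind S R X (s a) (g (t (s y))) := by
      intro a ha
      refine hT.ind_trans (C := g '' X ∪ g '' (s '' A)) ((hX.image g).union (hsA.image g)) ?_ ?_
      · rintro _ (hx | ⟨_, ⟨a', ha', rfl⟩, rfl⟩)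
        · exact hsW a ha _ (Or.inr hx)
        · exact hsg a ha a' ha'
      · have h1 := (htW (g⁻¹ (s a)) (Or.inr ⟨_, ⟨a, ha, rfl⟩, rfl⟩)).map g
        rw [aut_apply_inv_self, Set.image_union] at h1
        exact hT.symm (h1.mono hT.omits Set.subset_union_right)
    refine ⟨t * s, fun x hx => ?_, ?_, ?_⟩
    · rw [aut_mul_apply, hs x hx, ht x (Or.inl hx)]
    · rintro a (rfl | ha) c hc
      · exact lift c (fun a' ha' => hsW a' ha' c (Or.inl hc)) (htW c (Or.inl (Or.inl hc)))
      · rw [aut_mul_apply, htA a ha]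
        exact hsW a ha c (Or.inl hc)
    · rintro a (rfl | ha) a' (rfl | ha')
      · exact lift _ hAy htg
      · rw [aut_mul_apply, aut_mul_apply, htA a' ha']
        exact lift _ (fun b hb => hsg b hb a' ha')
          (htW _ (Or.inl (Or.inr ⟨_, ⟨a', ha', rfl⟩, rfl⟩)))
      · rw [aut_mul_apply, aut_mul_apply, htA a ha]
        exact hAy a ha
      · rw [aut_mul_apply, aut_mul_apply, htA a ha, htA a' ha']
        exact hsg a ha a' ha'

/-- The conjugate `h⁻¹gh`. -/
def conj (g h : M ≃[colourLanguage ι] M) : M ≃[colourLanguage ι] M := h⁻¹ * g * h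

@[simp] lemma conj_apply (g h : M ≃[colourLanguage ι] M) (x : M) :
    conj g h x = h⁻¹ (g (h x)) := rfl

lemma conj_mul (g h a : M ≃[colourLanguage ι] M) : conj g (h * a) = conj (conj g h) a := by
  simp only [conj, mul_inv_rev, mul_assoc]

lemma Tame.movesAlmostMaximally_conj (hT : Tame S R M) (hg : MovesAlmostMaximally S R g)
    (h : M ≃[colourLanguage ι] M) : MovesAlmostMaximally S R (conj g h) := by
  intro X hX a
  obtain ⟨_, ⟨s, hs, rfl⟩, hi⟩ := hg (h '' X) (hX.image h) (h a)
  rw [indep_singleton hT.complete] at hi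
  refine ⟨h⁻¹ (s (h a)), ⟨h⁻¹ * s * h, fun x hx => ?_, rfl⟩, ?_⟩
  · simp only [aut_mul_apply]
    rw [hs _ ⟨x, hx, rfl⟩, aut_inv_apply_self]
  · rw [indep_singleton hT.complete, conj_apply, aut_apply_inv_self]
    have := hi.map h⁻¹
    rw [← Set.image_comp] at this
    simpa [Function.comp_def] using this

/-- A conjugate of `g` by an automorphism that fixes `X` and `g X` agrees with `p` on `Y`. -/
lemma Tame.exists_conj_eq (hT : Tame S R M) (hg : MovesAlmostMaximally S R g)
    (p : M ≃[colourLanguage ι] M) {X Y : Set M} (hX : X.Finite) (hY : Y.Finite)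
    (hp : ∀ x ∈ X, p x = g x) (h₁ : ∀ y ∈ Y, ∀ x ∈ X, Ind S R X y (p x))
    (h₂ : ∀ y ∈ Y, ∀ x ∈ X, Ind S R (p '' X) (p y) x)
    (h₃ : ∀ y ∈ Y, ∀ y' ∈ Y, Ind S R (X ∪ p '' X) y (p y')) :
    ∃ a : M ≃[colourLanguage ι] M, (∀ x ∈ X ∪ p '' X, a x = x) ∧ ∀ y ∈ Y, conj g a y = p y := by
  have hc := hT.complete
  -- By stationarity, `s Y` and `g s Y` have the same colours among themselves and over `X ∪ g X` as
  -- `Y` and `p Y`. An automorphism matching the two configurations is the required conjugator.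
  obtain ⟨s, hs, hsW, hsg⟩ := hT.exists_ind_apply_set hg hY (W := p '' X ∪ ⇑(g⁻¹) '' X) hX
    ((hX.image _).union (hX.image _))
  have hgX : g '' X = p '' X := Set.image_congr fun x hx => (hp x hx).symm
  have hYX : ∀ y ∈ Y, ∀ x ∈ X, edge ι y x = edge ι (s y) x := fun y hy x hx => by
    conv_rhs => rw [← hs x hx]
    exact (edge_aut hc s y x).symm
  have hpYp : ∀ y ∈ Y, ∀ x ∈ p '' X, edge ι (p y) x = edge ι (g (s y)) x := by
    rintro y hy _ ⟨x, hx, rfl⟩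
    conv_rhs => rw [hp x hx]
    rw [edge_aut hc, edge_aut hc, hYX y hy x hx]
  have hYp : ∀ y ∈ Y, ∀ x ∈ p '' X, edge ι y x = edge ι (s y) x := by
    rintro y hy _ ⟨x, hx, rfl⟩
    refine Ind.edge_eq (S := S) (R := R) hc id (h₁ y hy x hx) ?_ (hYX y hy) (fun _ _ => rfl)
    rw [Set.image_id]
    exact hsW y hy _ (Or.inl ⟨x, hx, rfl⟩)
  have hpYX : ∀ y ∈ Y, ∀ x ∈ X, edge ι (p y) x = edge ι (g (s y)) x := by
    intro y hy x hx
    refine Ind.edge_eq (S := S) (R := R) hc id (h₂ y hy x hx) ?_ (hpYp y hy) (fun _ _ => rfl)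
    have := (hsW y hy _ (Or.inr ⟨x, hx, rfl⟩)).map g
    rw [Set.image_id]
    rwa [aut_apply_inv_self, hgX] at this
  have hYZ : ∀ y ∈ Y, ∀ x ∈ X ∪ p '' X, edge ι y x = edge ι (s y) x := fun y hy x hx =>
    hx.elim (hYX y hy x) (hYp y hy x)
  have hpYZ : ∀ y ∈ Y, ∀ x ∈ X ∪ p '' X, edge ι (p y) x = edge ι (g (s y)) x := fun y hy x hx =>
    hx.elim (hpYX y hy x) (hpYp y hy x)
  have hYpY : ∀ y ∈ Y, ∀ y' ∈ Y, edge ι y (p y') = edge ι (s y) (g (s y')) := fun y hy y' hy' => by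
    refine Ind.edge_eq (S := S) (R := R) hc id (h₃ y hy y' hy') ?_ (hYZ y hy) (hpYZ y' hy')
    rw [Set.image_id]
    exact (hsg y hy y' hy').mono hT.omits Set.subset_union_left
  obtain ⟨a, ha⟩ := hT.homogeneous ((fun x => (x, x)) '' (X ∪ p '' X) ∪
    ((fun y => (y, s y)) '' Y ∪ (fun y => (p y, g (s y))) '' Y))
    (((hX.union (hX.image _)).image _).union ((hY.image _).union (hY.image _))) (by
      rintro _ (⟨x, hx, rfl⟩ | ⟨y, hy, rfl⟩ | ⟨y, hy, rfl⟩)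
        _ (⟨x', hx', rfl⟩ | ⟨y', hy', rfl⟩ | ⟨y', hy', rfl⟩) <;> dsimp only
      · rw [edge_comm hc, edge_comm hc x]
        exact hYZ y' hy' x hx
      · rw [edge_comm hc, edge_comm hc x]
        exact hpYZ y' hy' x hx
      · exact hYZ y hy x' hx'
      · rw [edge_aut hc]
      · exact hYpY y hy y' hy'
      · exact hpYZ y hy x' hx'
      · rw [edge_comm hc, edge_comm hc (g _)]
        exact hYpY y' hy' y hy
      · rw [edge_aut hc, edge_aut hc, edge_aut hc])
  refine ⟨a, fun x hx => ha _ (Or.inl ⟨x, hx, rfl⟩), fun y hy => ?_⟩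
  have h1 : a y = s y := ha _ (Or.inr (Or.inl ⟨y, hy, rfl⟩))
  have h2 : a (p y) = g (s y) := ha _ (Or.inr (Or.inr ⟨y, hy, rfl⟩))
  rw [conj_apply, aut_inv_apply_eq, h1, h2]

/-- Conjugating by an automorphism that fixes `X` and `g X`, the image of `Y` can be made
independent from `C`. -/
lemma Tame.exists_conj_ind (hT : Tame S R M) (hg : MovesAlmostMaximally S R g) {X Y C : Set M}
    (hX : X.Finite) (hY : Y.Finite) (hC : C.Finite)
    (h : ∀ x ∈ X, ∀ c ∈ C, Ind S R (g '' X) x c) :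
    ∃ a : M ≃[colourLanguage ι] M, (∀ x ∈ X ∪ g '' X, a x = x) ∧
      ∀ y ∈ Y, ∀ c ∈ C, Ind S R (g '' X) (conj g a y) c := by
  have hZ : (X ∪ g '' X).Finite := hX.union (hX.image g)
  obtain ⟨s, hs, -, hsg⟩ := hT.exists_ind_apply_set hg hY hZ Set.finite_empty
  have hs' : ∀ x ∈ X ∪ g '' X, s⁻¹ x = x := fun x hx => aut_inv_apply_eq_self (hs x hx)
  obtain ⟨t, ht, hti⟩ := hT.exists_generic_set (hY.image (conj g s)) (hZ.union hY) hC
  have ht' : ∀ x ∈ (X ∪ g '' X) ∪ Y, t⁻¹ x = x := fun x hx => aut_inv_apply_eq_self (ht x hx)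
  refine ⟨s * t⁻¹, fun x hx => ?_, fun y hy c hc => ?_⟩
  · rw [aut_mul_apply, ht' x (Or.inl hx), hs x hx]
  have hy' : conj g (s * t⁻¹) y = t (conj g s y) := by
    rw [conj_mul, conj_apply (conj g s), ht' y (Or.inr hy), inv_inv]
  rw [hy']
  -- The image of `y` is independent from `Y` over `X ∪ g X` by the choice of `s`, and from `C` over
  -- this base with `Y` added by the choice of `t`.
  have h1 : Ind S R (X ∪ g '' X) (t (conj g s y)) c := by
    refine hT.ind_trans hY (fun z hz => ?_) (hti _ ⟨y, hy, rfl⟩ c hc)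
    have h2 := (hsg z hz y hy).fix hs'
    rw [aut_inv_apply_self] at h2
    have h3 := h2.fix (s := t) fun x hx => ht x (Or.inl hx)
    rw [ht z (Or.inr hz)] at h3
    exact hT.symm h3
  refine hT.symm (hT.ind_trans hX (fun x hx => hT.symm (h x hx c hc)) ?_)
  rw [Set.union_comm]
  exact hT.symm h1

end AlmostMaximal

/-! ### Products of two conjugates -/

section HalfWords

variable {ι : Type u} {S : Set (Sym ι 3)} {m : ℕ} {R : Fin m → ι}

/-- A pair of automorphisms, which stands for the product of two conjugates of some `g`. -/
structure Half (ι : Type u) (M : Type w) [(colourLanguage ι).Structure M] where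
  /-- the automorphism that gives the first conjugate -/
  fst : M ≃[colourLanguage ι] M
  /-- the automorphism that gives the second conjugate -/
  snd : M ≃[colourLanguage ι] M

variable {M : Type w} [(colourLanguage ι).Structure M] {g : M ≃[colourLanguage ι] M}

/-- The first conjugate. -/
def Half.one (g : M ≃[colourLanguage ι] M) (H : Half ι M) : M ≃[colourLanguage ι] M :=
  conj g H.fst

/-- The product of both conjugates. -/
def Half.two (g : M ≃[colourLanguage ι] M) (H : Half ι M) : M ≃[colourLanguage ι] M :=
  conj g H.snd * conj g H.fst

/-- `H'` agrees with `H` on the paths that start in `X`. -/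
structure Half.Agrees (g : M ≃[colourLanguage ι] M) (H H' : Half ι M) (X : Set M) : Prop where
  fst_start : ∀ x ∈ X, H'.fst x = H.fst x
  fst_one : ∀ x ∈ X, H'.fst (H.one g x) = H.fst (H.one g x)
  snd_one : ∀ x ∈ X, H'.snd (H.one g x) = H.snd (H.one g x)
  snd_two : ∀ x ∈ X, H'.snd (H.two g x) = H.snd (H.two g x)

/-- The value of `h⁻¹gh` at `x` depends on `h` only at `x` and at that value; this is why
`Half.Agrees` records the conjugators at consecutive points of each path. -/
lemma conj_eq_of_agree {h h' : M ≃[colourLanguage ι] M} {x : M} (h1 : h' x = h x)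
    (h2 : h' (conj g h x) = h (conj g h x)) : conj g h' x = conj g h x := by
  rw [conj_apply g h', aut_inv_apply_eq, h1, h2, conj_apply, aut_apply_inv_self]

lemma Half.Agrees.one_eq {H H' : Half ι M} {X : Set M} (h : H.Agrees g H' X) {x : M}
    (hx : x ∈ X) : H'.one g x = H.one g x :=
  conj_eq_of_agree (h.fst_start x hx) (h.fst_one x hx)

lemma Half.Agrees.two_eq {H H' : Half ι M} {X : Set M} (h : H.Agrees g H' X) {x : M}
    (hx : x ∈ X) : H'.two g x = H.two g x := by
  change conj g H'.snd (H'.one g x) = conj g H.snd (H.one g x)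
  rw [h.one_eq hx]
  exact conj_eq_of_agree (h.snd_one x hx) (h.snd_two x hx)

lemma Half.Agrees.trans {H H' H'' : Half ι M} {X Y : Set M} (h : H.Agrees g H' X)
    (h' : H'.Agrees g H'' Y) (hXY : X ⊆ Y) : H.Agrees g H'' X where
  fst_start x hx := by rw [h'.fst_start x (hXY hx), h.fst_start x hx]
  fst_one x hx := by
    have := h'.fst_one x (hXY hx)
    rwa [h.one_eq hx, h.fst_one x hx] at this
  snd_one x hx := by
    have := h'.snd_one x (hXY hx)
    rwa [h.one_eq hx, h.snd_one x hx] at this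
  snd_two x hx := by
    have := h'.snd_two x (hXY hx)
    rwa [h.two_eq hx, h.snd_two x hx] at this

/-- The end points of the paths from `X` are independent over the middle. -/
def Half.Good (S : Set (Sym ι 3)) (R : Fin m → ι) (g : M ≃[colourLanguage ι] M) (H : Half ι M)
    (X : Set M) : Prop :=
  ∀ x ∈ X, ∀ y ∈ X, Ind S R (H.one g '' X) x (H.two g y)

/-- The paths of `H` from `X` cover `Z`, as do the images under the automorphisms in `H`. -/
structure Half.Covers (g : M ≃[colourLanguage ι] M) (H : Half ι M) (X Z : Set M) : Prop where
  mid : ∀ z ∈ Z, ∃ x ∈ X, H.one g x = z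
  fst : ∀ z ∈ Z, ∃ x ∈ X, H.fst (H.one g x) = z
  snd : ∀ z ∈ Z, ∃ x ∈ X, H.snd (H.one g x) = z

lemma Half.exists_limit (H : ℕ → Half ι M) (X : ℕ → Set M) (hX : ∀ n, X n ⊆ X (n + 1))
    (agree : ∀ n, (H n).Agrees g (H (n + 1)) (X n))
    (cover : ∀ z, ∃ n, (H n).Covers g (X n) {z}) :
    ∃ K : Half ι M, ∀ n, (H n).Agrees g K (X n) := by
  obtain ⟨F, hF⟩ := SemiFree.exists_limit (fun n => (H n).fst) (fun n => X n ∪ (H n).one g '' X n)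
    (fun n => Set.union_subset_union (hX n) (by
      rintro _ ⟨x, hx, rfl⟩
      exact ⟨x, hX n hx, (agree n).one_eq hx⟩))
    (by
      rintro n x (hx | ⟨x, hx, rfl⟩)
      · exact (agree n).fst_start x hx
      · exact (agree n).fst_one x hx)
    (fun z => by
      obtain ⟨n, hn⟩ := cover z
      exact ⟨n, Or.inr (hn.mid z rfl)⟩)
    (fun z => by
      obtain ⟨n, hn⟩ := cover z
      obtain ⟨x, hx, hz⟩ := hn.fst z rfl
      exact ⟨n, _, Or.inr ⟨x, hx, rfl⟩, hz⟩)
  obtain ⟨G, hG⟩ := SemiFree.exists_limit (fun n => (H n).snd)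
    (fun n => (H n).one g '' X n ∪ (H n).two g '' X n)
    (fun n => Set.union_subset_union (by
      rintro _ ⟨x, hx, rfl⟩
      exact ⟨x, hX n hx, (agree n).one_eq hx⟩) (by
      rintro _ ⟨x, hx, rfl⟩
      exact ⟨x, hX n hx, (agree n).two_eq hx⟩))
    (by
      rintro n _ (⟨x, hx, rfl⟩ | ⟨x, hx, rfl⟩)
      · exact (agree n).snd_one x hx
      · exact (agree n).snd_two x hx)
    (fun z => by
      obtain ⟨n, hn⟩ := cover z
      exact ⟨n, Or.inl (hn.mid z rfl)⟩)
    (fun z => by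
      obtain ⟨n, hn⟩ := cover z
      obtain ⟨x, hx, hz⟩ := hn.snd z rfl
      exact ⟨n, _, Or.inl ⟨x, hx, rfl⟩, hz⟩)
  exact ⟨⟨F, G⟩, fun n => ⟨fun x hx => hF n x (Or.inl hx), fun x hx => hF n _ (Or.inr ⟨x, hx, rfl⟩),
    fun x hx => hG n _ (Or.inl ⟨x, hx, rfl⟩), fun x hx => hG n _ (Or.inr ⟨x, hx, rfl⟩)⟩⟩

/-- The first conjugate can be changed so that it maps `Y` to points that are independent from the
end points of the paths from `X`. -/
lemma Tame.exists_fst (hT : Tame S R M) (hg : MovesAlmostMaximally S R g) {H : Half ι M}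
    {X Y : Set M} (hX : X.Finite) (hY : Y.Finite) (hH : H.Good S R g X) :
    ∃ h : M ≃[colourLanguage ι] M, (∀ x ∈ X, h x = H.fst x) ∧
      (∀ x ∈ X, h (H.one g x) = H.fst (H.one g x)) ∧
      ∀ y ∈ Y, ∀ x ∈ X, Ind S R (H.one g '' X) (conj g h y) (H.two g x) := by
  obtain ⟨a, ha, hai⟩ := hT.exists_conj_ind (hT.movesAlmostMaximally_conj hg H.fst) hX hY
    (hX.image (H.two g)) (by
      rintro x hx _ ⟨y, hy, rfl⟩
      exact hH x hx y hy)
  refine ⟨H.fst * a, fun x hx => ?_, fun x hx => ?_, fun y hy x hx => ?_⟩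
  · rw [aut_mul_apply, ha x (Or.inl hx)]
  · rw [aut_mul_apply, ha (H.one g x) (Or.inr ⟨x, hx, rfl⟩)]
  · rw [conj_mul]
    exact hai y hy _ ⟨x, hx, rfl⟩

/-- The second conjugate can be changed so that the product of both agrees with `φ` on `Y`. -/
lemma Tame.exists_snd (hT : Tame S R M) (hg : MovesAlmostMaximally S R g) {H : Half ι M}
    {X Y : Set M} (hX : X.Finite) (hY : Y.Finite) {h φ : M ≃[colourLanguage ι] M}
    (hh : ∀ x ∈ X, h x = H.fst x) (hh' : ∀ x ∈ X, h (H.one g x) = H.fst (H.one g x))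
    (hφ : ∀ x ∈ X, φ x = H.two g x)
    (h₁ : ∀ y ∈ Y, ∀ x ∈ X, Ind S R (H.one g '' X) (conj g h y) (H.two g x))
    (h₂ : ∀ y ∈ Y, ∀ x ∈ X, Ind S R (H.two g '' X) (φ y) (H.one g x))
    (h₃ : ∀ y ∈ Y, ∀ y' ∈ Y, Ind S R (H.two g '' X) (φ y) (conj g h y')) :
    ∃ H' : Half ι M, H.Agrees g H' X ∧ ∀ y ∈ Y, H'.two g y = φ y := by
  have hone : ∀ x ∈ X, conj g h x = H.one g x := fun x hx =>
    conj_eq_of_agree (hh x hx) (hh' x hx)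
  have hp : ∀ x ∈ X, (φ * (conj g h)⁻¹) (H.one g x) = H.two g x := fun x hx => by
    rw [aut_mul_apply, ← hone x hx, aut_inv_apply_self, hφ x hx]
  have himage : (φ * (conj g h)⁻¹) '' (H.one g '' X) = H.two g '' X := by
    rw [← Set.image_comp]
    exact Set.image_congr hp
  obtain ⟨a, ha, haY⟩ := hT.exists_conj_eq (hT.movesAlmostMaximally_conj hg H.snd)
    (φ * (conj g h)⁻¹) (hX.image (H.one g)) (hY.image (conj g h)) (by
      rintro _ ⟨x, hx, rfl⟩
      exact hp x hx) (by
      rintro _ ⟨y, hy, rfl⟩ _ ⟨x, hx, rfl⟩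
      rw [hp x hx]
      exact h₁ y hy x hx) (by
      rintro _ ⟨y, hy, rfl⟩ _ ⟨x, hx, rfl⟩
      rw [himage, aut_mul_apply, aut_inv_apply_self]
      exact h₂ y hy x hx) (by
      rintro _ ⟨y, hy, rfl⟩ _ ⟨y', hy', rfl⟩
      rw [himage, aut_mul_apply, aut_inv_apply_self]
      exact hT.symm ((h₃ y' hy' y hy).mono hT.omits Set.subset_union_right))
  rw [himage] at ha
  refine ⟨⟨h, H.snd * a⟩, ⟨hh, hh', fun x hx => ?_, fun x hx => ?_⟩, fun y hy => ?_⟩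
  · rw [aut_mul_apply, ha _ (Or.inl ⟨x, hx, rfl⟩)]
  · rw [aut_mul_apply, ha _ (Or.inr ⟨x, hx, rfl⟩)]
  · have := haY _ ⟨y, hy, rfl⟩
    rw [← conj_mul, aut_mul_apply, aut_inv_apply_self] at this
    exact this

/-- The paths from a finite set can be enlarged to a good set of paths with middle points `P`. -/
lemma Tame.exists_good (hT : Tame S R M) (H : Half ι M) {P A Z : Set M} (hP : P.Finite)
    (hA : A ⊆ P) (hA' : H.one g '' A ⊆ P) (hZ : Z ⊆ P) (hZ' : ⇑H.fst⁻¹ '' Z ⊆ P)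
    (hZ'' : ⇑H.snd⁻¹ '' Z ⊆ P) :
    ∃ H' : Half ι M, H'.snd = H.snd ∧ H.Agrees g H' A ∧ A ⊆ ⇑(H'.one g)⁻¹ '' P ∧
      H'.Good S R g (⇑(H'.one g)⁻¹ '' P) ∧ H'.Covers g (⇑(H'.one g)⁻¹ '' P) Z := by
  -- Since `t` fixes the middle points `P`, replacing `H.fst` by `H.fst * t⁻¹` moves just their
  -- starting points by `t`, away from the end points, while `H.snd` is untouched.
  obtain ⟨t, ht, hti⟩ := hT.exists_generic_set (hP.image ⇑(H.one g)⁻¹) hP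
    (hP.image (conj g H.snd))
  have ht' : ∀ x ∈ P, t⁻¹ x = x := fun x hx => aut_inv_apply_eq_self (ht x hx)
  obtain ⟨H', hH'⟩ : ∃ H' : Half ι M, H' = ⟨H.fst * t⁻¹, H.snd⟩ := ⟨_, rfl⟩
  have hsnd : H'.snd = H.snd := by rw [hH']
  have hfst : ∀ x ∈ P, H'.fst x = H.fst x := fun x hx => by
    rw [hH', aut_mul_apply, ht' x hx]
  have hinv : ∀ x ∈ P, (H'.one g)⁻¹ x = t ((H.one g)⁻¹ x) := fun x hx => by
    rw [aut_inv_apply_eq, hH', Half.one, conj_mul, conj_apply (conj g H.fst), inv_inv,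
      aut_inv_apply_self]
    exact ((congrArg t (aut_apply_inv_self (H.one g) x)).trans (ht x hx)).symm
  have hagree : H.Agrees g H' A := ⟨fun x hx => hfst x (hA hx),
    fun x hx => hfst _ (hA' ⟨x, hx, rfl⟩), fun _ _ => by rw [hsnd], fun _ _ => by rw [hsnd]⟩
  refine ⟨H', hsnd, hagree, fun x hx => ⟨H.one g x, hA' ⟨x, hx, rfl⟩, ?_⟩, ?_, ?_, ?_, ?_⟩
  · rw [aut_inv_apply_eq, hagree.one_eq hx]
  · rintro _ ⟨x, hx, rfl⟩ _ ⟨y, hy, rfl⟩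
    have hbase : H'.one g '' (⇑(H'.one g)⁻¹ '' P) = P := by
      rw [← Set.image_comp]
      refine (Set.image_congr fun x _ => ?_).trans (Set.image_id' P)
      exact aut_apply_inv_self _ _
    rw [hbase, hinv x hx]
    refine hti _ ⟨x, hx, rfl⟩ _ ⟨y, hy, ?_⟩
    change _ = conj g H'.snd (H'.one g _)
    rw [aut_apply_inv_self, hsnd]
  · exact fun z hz => ⟨_, ⟨z, hZ hz, rfl⟩, aut_apply_inv_self _ _⟩
  · intro z hz
    have hp : H.fst⁻¹ z ∈ P := hZ' ⟨z, hz, rfl⟩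
    exact ⟨_, ⟨_, hp, rfl⟩, by rw [aut_apply_inv_self, hfst _ hp, aut_apply_inv_self]⟩
  · intro z hz
    have hp : H.snd⁻¹ z ∈ P := hZ'' ⟨z, hz, rfl⟩
    exact ⟨_, ⟨_, hp, rfl⟩, by rw [aut_apply_inv_self, hsnd, aut_apply_inv_self]⟩

lemma Half.two_image_inv_one (H : Half ι M) (P : Set M) :
    H.two g '' (⇑(H.one g)⁻¹ '' P) = conj g H.snd '' P := by
  rw [← Set.image_comp]
  refine Set.image_congr fun x _ => ?_
  change conj g H.snd (H.one g _) = _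
  rw [aut_apply_inv_self]

end HalfWords

/-! ### Products of four conjugates and simplicity -/

section Words

variable {ι : Type u} {S : Set (Sym ι 3)} {m : ℕ} {R : Fin m → ι}

/-- Two halves, which stand for a product of four conjugates of some `g` or its inverse. -/
structure Word (ι : Type u) (M : Type w) [(colourLanguage ι).Structure M] where
  /-- the first half -/
  left : Half ι M
  /-- the second half, read backwards -/
  right : Half ι M

variable {M : Type w} [(colourLanguage ι).Structure M] {g : M ≃[colourLanguage ι] M}

/-- The product that a word stands for. -/
def Word.val (g : M ≃[colourLanguage ι] M) (W : Word ι M) : M ≃[colourLanguage ι] M :=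
  (W.right.two g)⁻¹ * W.left.two g

/-- `W'` agrees with `W` on the paths that start in `X`. -/
structure Word.Agrees (g : M ≃[colourLanguage ι] M) (W W' : Word ι M) (X : Set M) : Prop where
  left : W.left.Agrees g W'.left X
  right : W.right.Agrees g W'.right (W.val g '' X)

/-- Both halves are good for the paths from `X`. -/
structure Word.Good (S : Set (Sym ι 3)) (R : Fin m → ι) (g : M ≃[colourLanguage ι] M)
    (W : Word ι M) (X : Set M) : Prop where
  finite : X.Finite
  left : W.left.Good S R g X
  right : W.right.Good S R g (W.val g '' X)

/-- The paths from `X` cover `Z` in both halves. -/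
structure Word.Covers (g : M ≃[colourLanguage ι] M) (W : Word ι M) (X Z : Set M) : Prop where
  start : Z ⊆ X
  left : W.left.Covers g X Z
  right : W.right.Covers g (W.val g '' X) Z

lemma Word.val_eq_iff {W : Word ι M} {x y : M} :
    W.val g x = y ↔ W.left.two g x = W.right.two g y := by
  rw [Word.val, aut_mul_apply, aut_inv_apply_eq]

lemma Word.Agrees.val_eq {W W' : Word ι M} {X : Set M} (h : W.Agrees g W' X) {x : M}
    (hx : x ∈ X) : W'.val g x = W.val g x := by
  rw [Word.val_eq_iff, h.left.two_eq hx, h.right.two_eq ⟨x, hx, rfl⟩, ← Word.val_eq_iff]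

lemma Word.Agrees.image_eq {W W' : Word ι M} {X : Set M} (h : W.Agrees g W' X) :
    W'.val g '' X = W.val g '' X :=
  Set.image_congr fun _ hx => h.val_eq hx

lemma Word.Agrees.trans {W W' W'' : Word ι M} {X Y : Set M} (h : W.Agrees g W' X)
    (h' : W'.Agrees g W'' Y) (hXY : X ⊆ Y) : W.Agrees g W'' X :=
  ⟨h.left.trans h'.left hXY, h.right.trans h'.right (by
    rw [← h.image_eq]
    exact Set.image_mono hXY)⟩

/-- The first conjugates are changed so that the new middle points are independent from the old
meeting points. The new meeting points `φ y` are then chosen generic over the old ones, so that the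
second conjugates of both halves can be made to reach them, from `y` on the left and from `w y` on
the right. -/
lemma Tame.fill (hT : Tame S R M) (hg : MovesAlmostMaximally S R g) {W : Word ι M} {X Y : Set M}
    (hW : W.Good S R g X) (hY : Y.Finite) {w : M ≃[colourLanguage ι] M}
    (hw : ∀ x ∈ X, W.val g x = w x) :
    ∃ W' : Word ι M, W.Agrees g W' X ∧ ∀ y ∈ Y, W'.val g y = w y := by
  have hX := hW.finite
  set V := W.val g '' X with hV
  have htwo : ∀ x ∈ X, W.right.two g (w x) = W.left.two g x := fun x hx =>
    (Word.val_eq_iff.1 (hw x hx)).symm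
  have himage : W.right.two g '' V = W.left.two g '' X := by
    rw [hV, ← Set.image_comp]
    exact Set.image_congr fun x hx => (congrArg _ (hw x hx)).trans (htwo x hx)
  obtain ⟨h, h1, h2, h3⟩ := hT.exists_fst hg hX hY hW.left
  obtain ⟨k, k1, k2, k3⟩ := hT.exists_fst hg (hX.image _) (hY.image w) hW.right
  obtain ⟨s, hs, hsi⟩ := hT.exists_generic_set
    (hY.image (conj g W.left.snd * conj g h)) (hX.image (W.left.two g))
    (((hX.image (W.left.one g)).union ((hX.image (W.val g)).image (W.right.one g))).union
      ((hY.image (conj g h)).union ((hY.image w).image (conj g k))))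
  have hone : ∀ x ∈ X, conj g h x = W.left.one g x := fun x hx =>
    conj_eq_of_agree (h1 x hx) (h2 x hx)
  let φ := s * (conj g W.left.snd * conj g h)
  have hφ : ∀ x ∈ X, φ x = W.left.two g x := fun x hx => by
    simp only [φ, aut_mul_apply]
    rw [hone x hx]
    exact hs _ ⟨x, hx, rfl⟩
  obtain ⟨L, hL, hLY⟩ := hT.exists_snd hg hX hY h1 h2 hφ h3
    (fun y hy x hx => hsi _ ⟨y, hy, rfl⟩ _ (Or.inl (Or.inl ⟨x, hx, rfl⟩)))
    (fun y hy y' hy' => hsi _ ⟨y, hy, rfl⟩ _ (Or.inr (Or.inl ⟨y', hy', rfl⟩)))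
  obtain ⟨K, hK, hKY⟩ := hT.exists_snd hg (φ := φ * w⁻¹) (hX.image _) (hY.image w) k1 k2 (by
      rintro _ ⟨x, hx, rfl⟩
      rw [hw x hx, aut_mul_apply, aut_inv_apply_self, hφ x hx, htwo x hx]) k3 (by
      rintro _ ⟨y, hy, rfl⟩ x hx
      rw [himage, aut_mul_apply, aut_inv_apply_self]
      exact hsi _ ⟨y, hy, rfl⟩ _ (Or.inl (Or.inr ⟨x, hx, rfl⟩))) (by
      rintro _ ⟨y, hy, rfl⟩ y' hy'
      rw [himage, aut_mul_apply, aut_inv_apply_self]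
      exact hsi _ ⟨y, hy, rfl⟩ _ (Or.inr (Or.inr ⟨y', hy', rfl⟩)))
  refine ⟨⟨L, K⟩, ⟨hL, hK⟩, fun y hy => Word.val_eq_iff.2 ?_⟩
  change L.two g y = K.two g (w y)
  rw [hLY y hy, hKY _ ⟨y, hy, rfl⟩]
  exact (congrArg φ (aut_inv_apply_self w y)).symm

/-- One finite set `P` of meeting points is fixed for both halves, large enough for the required
covering. Its preimages under the second conjugates are the middle points; only the first conjugates
change. Both halves end exactly in `P`, so the word maps one set of starting points onto the other.
-/
lemma Tame.restore (hT : Tame S R M) (W : Word ι M) {X Z : Set M} (hX : X.Finite)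
    (hZ : Z.Finite) (hZX : Z ⊆ X) :
    ∃ (W' : Word ι M) (X' : Set M), W.Agrees g W' X ∧ X ⊆ X' ∧ W'.Good S R g X' ∧
      W'.Covers g X' Z := by
  set need : Half ι M → Set M → Set M := fun H A =>
    A ∪ (H.one g '' A ∪ (Z ∪ (⇑H.fst⁻¹ '' Z ∪ ⇑H.snd⁻¹ '' Z))) with hneed
  have hfin : ∀ H A, A.Finite → (need H A).Finite := fun H A hA =>
    hA.union ((hA.image _).union (hZ.union ((hZ.image _).union (hZ.image _))))
  set P := conj g W.left.snd '' need W.left X ∪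
    conj g W.right.snd '' need W.right (W.val g '' X) with hP
  have hPf : P.Finite := ((hfin _ _ hX).image _).union ((hfin _ _ (hX.image _)).image _)
  have himage : ∀ h : M ≃[colourLanguage ι] M, h '' (⇑h⁻¹ '' P) = P := fun h => by
    rw [← Set.image_comp]
    refine (Set.image_congr fun x _ => ?_).trans (Set.image_id' P)
    exact aut_apply_inv_self _ _
  have half : ∀ H A, conj g H.snd '' need H A ⊆ P →
      ∃ H' : Half ι M, H'.snd = H.snd ∧ H.Agrees g H' A ∧
        A ⊆ ⇑(H'.one g)⁻¹ '' (⇑(conj g H.snd)⁻¹ '' P) ∧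
        H'.Good S R g (⇑(H'.one g)⁻¹ '' (⇑(conj g H.snd)⁻¹ '' P)) ∧
        H'.Covers g (⇑(H'.one g)⁻¹ '' (⇑(conj g H.snd)⁻¹ '' P)) Z := by
    intro H A hA
    have hsub : need H A ⊆ ⇑(conj g H.snd)⁻¹ '' P := fun x hx =>
      ⟨_, hA ⟨x, hx, rfl⟩, aut_inv_apply_self _ _⟩
    exact hT.exists_good H (hPf.image _) (fun x hx => hsub (Or.inl hx))
      (fun x hx => hsub (Or.inr (Or.inl hx))) (fun x hx => hsub (Or.inr (Or.inr (Or.inl hx))))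
      (fun x hx => hsub (Or.inr (Or.inr (Or.inr (Or.inl hx)))))
      (fun x hx => hsub (Or.inr (Or.inr (Or.inr (Or.inr hx)))))
  obtain ⟨L, hL, hLa, hLX, hLg, hLc⟩ := half W.left X Set.subset_union_left
  obtain ⟨K, hK, hKa, hKX, hKg, hKc⟩ := half W.right (W.val g '' X) Set.subset_union_right
  have hval : Word.val g ⟨L, K⟩ '' (⇑(L.one g)⁻¹ '' (⇑(conj g W.left.snd)⁻¹ '' P)) =
      ⇑(K.one g)⁻¹ '' (⇑(conj g W.right.snd)⁻¹ '' P) := by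
    apply (K.two g).injective.image_injective
    rw [Half.two_image_inv_one, hK, himage, ← Set.image_comp]
    refine (Set.image_congr fun x _ => ?_).trans
      ((L.two_image_inv_one _).trans (by rw [hL, himage]))
    exact aut_apply_inv_self _ _
  refine ⟨⟨L, K⟩, _, ⟨hLa, hKa⟩, hLX, ⟨(hPf.image _).image _, hLg, ?_⟩, hZX.trans hLX, hLc, ?_⟩
  · rwa [hval]
  · rwa [hval]

lemma Tame.fill_restore (hT : Tame S R M) (hg : MovesAlmostMaximally S R g) {W : Word ι M}
    {X Y Z : Set M} (hW : W.Good S R g X) (hY : Y.Finite) (hXY : X ⊆ Y) (hZ : Z.Finite)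
    {w : M ≃[colourLanguage ι] M} (hw : ∀ x ∈ X, W.val g x = w x) :
    ∃ (W' : Word ι M) (X' : Set M), W.Agrees g W' X ∧ Y ⊆ X' ∧ W'.Good S R g X' ∧
      W'.Covers g X' Z ∧ ∀ y ∈ Y, W'.val g y = w y := by
  obtain ⟨V, hV, hVw⟩ := hT.fill hg hW (hY.union hZ) hw
  obtain ⟨W', X', hW', hX', hgood, hcov⟩ := hT.restore (g := g) V (hY.union hZ) hZ
    Set.subset_union_right
  refine ⟨W', X', hV.trans hW' (hXY.trans Set.subset_union_left),
    Set.subset_union_left.trans hX', hgood, hcov, fun y hy => ?_⟩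
  rw [hW'.val_eq (Or.inl hy), hVw y (Or.inl hy)]

lemma Word.exists_limit (W : ℕ → Word ι M) (X : ℕ → Set M) (hX : ∀ n, X n ⊆ X (n + 1))
    (agree : ∀ n, (W n).Agrees g (W (n + 1)) (X n))
    (cover : ∀ z, ∃ n, (W n).Covers g (X n) {z}) :
    ∃ V : Word ι M, ∀ n, ∀ x ∈ X n, V.val g x = (W n).val g x := by
  obtain ⟨L, hL⟩ := Half.exists_limit (fun n => (W n).left) X hX (fun n => (agree n).left)
    (fun z => (cover z).imp fun n hn => hn.left)
  obtain ⟨K, hK⟩ := Half.exists_limit (fun n => (W n).right) (fun n => (W n).val g '' X n)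
    (fun n => by
      rw [← (agree n).image_eq]
      exact Set.image_mono (hX n)) (fun n => (agree n).right)
    (fun z => (cover z).imp fun n hn => hn.right)
  exact ⟨⟨L, K⟩, fun n x hx => Word.Agrees.val_eq ⟨hL n, hK n⟩ hx⟩

/-- The back-and-forth system: `U` and `V` are good and `U = V f` as far as they are determined. -/
structure Linked (S : Set (Sym ι 3)) (R : Fin m → ι) (g f : M ≃[colourLanguage ι] M)
    (U V : Word ι M) (X Y : Set M) : Prop where
  left : U.Good S R g X
  right : V.Good S R g Y
  sub : ∀ y ∈ Y, f⁻¹ y ∈ X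
  eq : ∀ y ∈ Y, V.val g y = U.val g (f⁻¹ y)

/-- The roles of the two words are exchanged and `f` is inverted, so the same step serves for going
forth and back. -/
lemma Tame.linked_step (hT : Tame S R M) (hg : MovesAlmostMaximally S R g)
    {f : M ≃[colourLanguage ι] M} {U V : Word ι M} {X Y : Set M} (h : Linked S R g f U V X Y)
    {Z : Set M} (hZ : Z.Finite) :
    ∃ (V' : Word ι M) (Y' : Set M), Linked S R g f⁻¹ V' U Y' X ∧ V.Agrees g V' Y ∧ Y ⊆ Y' ∧
      V'.Covers g Y' Z := by
  have hsub : Y ⊆ f '' X := fun y hy => ⟨_, h.sub y hy, aut_apply_inv_self _ _⟩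
  obtain ⟨V', Y', h1, h2, h3, h4, h5⟩ := hT.fill_restore hg h.right (h.left.finite.image f) hsub hZ
    (w := U.val g * f⁻¹) h.eq
  refine ⟨V', Y', ⟨h3, h.left, fun x hx => h2 ⟨x, hx, (by rw [inv_inv])⟩, fun x hx => ?_⟩, h1,
    hsub.trans h2, h4⟩
  rw [inv_inv, h5 _ ⟨x, hx, rfl⟩, aut_mul_apply, aut_inv_apply_self]

/-- If `g` moves almost maximally, then every automorphism is a product of two values of words in
the conjugates of `g`. -/
theorem Tame.exists_words [Countable M] (hT : Tame S R M) (hg : MovesAlmostMaximally S R g)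
    (f : M ≃[colourLanguage ι] M) : ∃ U V : Word ι M, f = (V.val g)⁻¹ * U.val g := by
  rcases isEmpty_or_nonempty M with hM | hM
  · exact ⟨⟨⟨1, 1⟩, ⟨1, 1⟩⟩, ⟨⟨1, 1⟩, ⟨1, 1⟩⟩, FirstOrder.Language.Equiv.ext fun x =>
      (hM.false x).elim⟩
  obtain ⟨z, hz⟩ := exists_surjective_nat M
  let w₀ : Word ι M := ⟨⟨1, 1⟩, ⟨1, 1⟩⟩
  have hgood₀ : w₀.Good S R g ∅ := ⟨Set.finite_empty, by rintro x ⟨⟩, by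
    rintro x ⟨y, hy, -⟩
    exact hy.elim⟩
  obtain ⟨s, -, hs⟩ := exists_seq_of_step
    (σ := (Word ι M × Set M) × (Word ι M × Set M))
    (fun s => Linked S R g f s.1.1 s.2.1 s.1.2 s.2.2)
    (fun n s s' => (s.1.1.Agrees g s'.1.1 s.1.2 ∧ s.1.2 ⊆ s'.1.2 ∧ s'.1.1.Covers g s'.1.2 {z n}) ∧
      (s.2.1.Agrees g s'.2.1 s.2.2 ∧ s.2.2 ⊆ s'.2.2 ∧ s'.2.1.Covers g s'.2.2 {z n}))
    ((w₀, ∅), (w₀, ∅)) ⟨hgood₀, hgood₀, by simp, by simp⟩ (by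
      rintro n ⟨⟨U, X⟩, ⟨V, Y⟩⟩ h
      obtain ⟨V', Y', h1, h2, h3, h4⟩ := hT.linked_step hg h (Set.finite_singleton (z n))
      obtain ⟨U', X', k1, k2, k3, k4⟩ := hT.linked_step hg h1 (Set.finite_singleton (z n))
      rw [inv_inv] at k1
      exact ⟨((U', X'), (V', Y')), k1, ⟨k2, k3, k4⟩, h2, h3, h4⟩)
  have hcover : ∀ x, ∃ n, (s n).1.1.Covers g (s n).1.2 {x} ∧ (s n).2.1.Covers g (s n).2.2 {x} :=
    fun x => by
      obtain ⟨n, rfl⟩ := hz x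
      exact ⟨n + 1, (hs n).2.1.2.2, (hs n).2.2.2.2⟩
  obtain ⟨U, hU⟩ := Word.exists_limit (fun n => (s n).1.1) (fun n => (s n).1.2)
    (fun n => (hs n).2.1.2.1) (fun n => (hs n).2.1.1) (fun x => (hcover x).imp fun n hn => hn.1)
  obtain ⟨V, hV⟩ := Word.exists_limit (fun n => (s n).2.1) (fun n => (s n).2.2)
    (fun n => (hs n).2.2.2.1) (fun n => (hs n).2.2.1) (fun x => (hcover x).imp fun n hn => hn.2)
  refine ⟨U, V, FirstOrder.Language.Equiv.ext fun x => ?_⟩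
  obtain ⟨n, -, hn⟩ := hcover (f x)
  have hfx : f x ∈ (s n).2.2 := hn.start rfl
  have h1 := (hs n).1.sub _ hfx
  have h2 := (hs n).1.eq _ hfx
  rw [aut_inv_apply_self] at h1 h2
  symm
  rw [aut_mul_apply, aut_inv_apply_eq, hU n x h1, hV n _ hfx, h2]

/-- The normal closure of an automorphism that moves almost maximally is the whole group. -/
theorem Tame.mem_normal [Countable M] (hT : Tame S R M) (hg : MovesAlmostMaximally S R g)
    {N : Subgroup (M ≃[colourLanguage ι] M)} (hN : N.Normal) (hgN : g ∈ N)
    (f : M ≃[colourLanguage ι] M) : f ∈ N := by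
  obtain ⟨U, V, rfl⟩ := hT.exists_words hg f
  have hconj : ∀ h, conj g h ∈ N := fun h => by simpa [conj] using hN.conj_mem g hgN h⁻¹
  have hhalf : ∀ H : Half ι M, H.two g ∈ N := fun H => N.mul_mem (hconj _) (hconj _)
  have hword : ∀ W : Word ι M, W.val g ∈ N := fun W =>
    N.mul_mem (N.inv_mem (hhalf _)) (hhalf _)
  exact N.mul_mem (N.inv_mem (hword V)) (hword U)

/-- A normal subgroup containing some `g ≠ 1` contains its double commutators, one of which moves
almost maximally and so generates everything as a normal subgroup. -/
theorem Tame.isSimpleGroup [Countable M] (hT : Tame S R M) (hR : Function.Injective R)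
    (hproper : Set.range R ⊂ Set.univ) : IsSimpleGroup (M ≃[colourLanguage ι] M) := by
  have hnontriv : ∃ s : M ≃[colourLanguage ι] M, s ≠ 1 := by
    obtain ⟨t, -, -⟩ := Set.exists_of_ssubset hproper
    obtain ⟨b, -, -⟩ := hT.extension ∅ Set.finite_empty (fun _ => t) (by simp)
    obtain ⟨s, -, -, hs⟩ := hT.exists_generic Set.finite_empty (Set.finite_singleton b)
      (Set.notMem_empty b)
    exact ⟨s, fun h => hs (by rw [h]; rfl)⟩
  obtain ⟨s, hs⟩ := hnontriv
  have : Nontrivial (M ≃[colourLanguage ι] M) := ⟨s, 1, hs⟩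
  refine ⟨fun N hN => ?_⟩
  rw [or_iff_not_imp_left, Subgroup.eq_bot_iff_forall]
  intro hbot
  push Not at hbot
  obtain ⟨g, hgN, hg⟩ := hbot
  obtain ⟨k, h, hkh⟩ := hT.exists_comm_comm hR hproper hg
  have hcomm : ∀ {c} (h : M ≃[colourLanguage ι] M), c ∈ N → comm h c ∈ N := fun {c} h hc => by
    refine N.mul_mem ?_ hc
    simpa using hN.conj_mem c⁻¹ (N.inv_mem hc) h⁻¹
  rw [Subgroup.eq_top_iff']
  exact hT.mem_normal hkh hN (hcomm k (hcomm h hgN))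

end Words

end SemiFree

theorem mainTheorem3 {ι : Type u} [Finite ι] {m : ℕ} (R : Fin m → ι)
    (hR : Function.Injective R) (S : Set (Sym ι 3))
    (hS : SemiFree.IsSemiFreeAmalgamationClass (SemiFree.Forb.{u, w} S) (Set.range R))
    (hcond : SemiFree.Condition1 S R ∨
      ∃ h : m = 2, SemiFree.Condition2 S (R ⟨0, by omega⟩) (R ⟨1, by omega⟩)) :
    SemiFree.IsPrioritisedClass.{u, w} S R ∧
    ∀ (M : Type w) [(SemiFree.colourLanguage ι).Structure M] [Countable M],
      FirstOrder.Language.IsFraisseLimit (SemiFree.Forb S) M →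
        SemiFree.MainCondition M S R ∧
        (∀ g : M ≃[SemiFree.colourLanguage ι] M, g ≠ 1 →
          ∃ k h : M ≃[SemiFree.colourLanguage ι] M,
            SemiFree.MovesAlmostMaximally S R (SemiFree.comm k (SemiFree.comm h g))) ∧
        IsSimpleGroup (M ≃[SemiFree.colourLanguage ι] M) := by
  have hcond' : SemiFree.EitherCondition S R := hcond
  have hprio := SemiFree.isPrioritisedClass hR hS hcond'
  refine ⟨hprio, fun M _ _ hM => ?_⟩
  have hT : SemiFree.Tame S R M :=
    ⟨SemiFree.rich_of_limit hprio hM, SemiFree.goodColours_of_condition hR hcond'⟩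
  exact ⟨SemiFree.mainCondition hT.toGoodColours hT.complete,
    fun _ hg => hT.exists_comm_comm hR hS.proper hg, hT.isSimpleGroup hR hS.proper⟩
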